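/- **Setting.** Let $\mathcal A$ be the quasi-local $C^*$-algebra of the spin chain over $\mathbb Z$ with one-site algebra $M_d(\mathbb C)$ (the norm completion of the union of the strictly local algebras $\bigotimes_{p\le k\le q}M_d(\mathbb C)$), let $x^{(k)}\in\mathcal A$ be the matrix $x\in M_d(\mathbb C)$ placed at site $k$, and let $\tau$ be the translation, $\tau(x^{(k)})=x^{(k+1)}$. Let $\omega$ be a state on $\mathcal A$ that is translation invariant, $\omega\circ\tau=\omega$, and spatially $L_1$-clustering, i.e. $\sum_{\ell\in\mathbb Z}|\omega(x^{(0)}y^{(\ell)})-\omega(x^{(0)})\omega(y^{(0)})|<\infty$ for all $x,y\in M_d(\mathbb C)$. Let $v_1,\dots,v_{d^2}$ be Hermitian matrices in $M_d(\mathbb C)$ with $\mathrm{Tr}(v_\mu v_\nu)=\delta_{\mu\nu}$, let $\epsilon_\mu\in\mathbb R$, let $h=[h_{\mu\nu}]$ be a Hermitian and $C=[C_{\mu\nu}]$ a positive semi-definite $d^2\times d^2$ matrix. With $V^{(N)}_\mu=\frac1{\sqrt N}\sum_{k=0}^{N-1}v_\mu^{(k)}$ put $$\mathbb L^{(N)}[x]=i\Big[\sum_\mu\epsilon_\mu\sum_{k=0}^{N-1}v^{(k)}_\mu+\frac1N\sum_{\mu,\nu}h_{\mu\nu}\sum_{k,\ell=0}^{N-1}v_\mu^{(k)}v_\nu^{(\ell)}\,,\,x\Big]+\sum_{\mu,\nu}\frac{C_{\mu\nu}}2\Big([V^{(N)}_\mu,x]\,V^{(N)}_\nu+V^{(N)}_\mu\,[x,V^{(N)}_\nu]\Big),$$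 $\gamma^{(N)}_t=e^{t\mathbb L^{(N)}}$ on $\mathcal A$, and $\widetilde B_{\mu\nu}=\frac12(C_{\mu\nu}-C_{\nu\mu})+2i\,\mathrm{Re}\,h_{\mu\nu}$. **Theorem.** For every $t\ge0$ and every $\nu$ the macroscopic average $$\omega_\nu(t)=\lim_{N\to\infty}\omega\Big(\gamma_t^{(N)}\Big[\frac1N\sum_{k=0}^{N-1}v_\nu^{(k)}\Big]\Big)$$ exists and is real, and $t\mapsto\omega_\nu(t)$ is continuous on $[0,\infty)$. There is a family of $*$-automorphisms $\alpha_t$ ($t\ge0$) of $\mathcal A$ such that for every $t\ge0$ $$\lim_{N\to\infty}\omega\big(a\,\gamma^{(N)}_t[O]\,b\big)=\omega\big(a\,\alpha_t[O]\,b\big)\qquad\text{for all }a,b,O\in\mathcal A .$$ Moreover, for every $S\in\mathbb N$ and $t\ge 0$ the Hamiltonian $$H^{(S)}_t=-i\sum_{k=0}^{S-1}\sum_{\mu=1}^{d^2}\Big(\sum_{\nu=1}^{d^2}\widetilde B_{\mu\nu}\,\omega_\nu(t)+i\,\epsilon_\mu\Big)v_\mu^{(k)}$$ is self-adjoint, the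 time-ordered exponential $$U^{(S)}_t=\mathbf 1+\sum_{n=1}^\infty(-i)^n\int_0^tds_1\int_0^{s_1}ds_2\cdots\int_0^{s_{n-1}}ds_n\,H^{(S)}_{s_1}H^{(S)}_{s_2}\cdots H^{(S)}_{s_n}$$ converges absolutely in norm and is unitary, and $\alpha_t[O]=(U^{(S)}_t)^\dagger\,O\,U^{(S)}_t$ for every $O\in\mathcal A$ with support in $[0,S-1]$, i.e. every $O$ commuting with all $x^{(k)}$, $x\in M_d(\mathbb C)$, $k\notin[0,S-1]$. -/

import Mathlib

open Filter Topology
open scoped ComplexOrder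

noncomputable section

namespace SpinChain

/-! ### The chain of `d`-level systems on the configuration Hilbert space -/

/-- Configurations of the bi-infinite chain: one of `d` levels at each site of `ℤ`. -/
abbrev Config (d : ℕ) : Type := ℤ → Fin d

/-- The Hilbert space of square-summable functions on the set of all configurations. -/
abbrev ConfigSpace (d : ℕ) : Type := lp (fun _ : Config d => ℂ) 2

/-- Exchange of the level at site `k` with an external level. -/
def exchange {d : ℕ} (k : ℤ) : Config d × Fin d ≃ Config d × Fin d :=
  Function.Involutive.toPerm
    (fun p : Config d × Fin d => (Function.update p.1 k p.2, p.1 k))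
    (fun p => by simp)

theorem exchange_apply {d : ℕ} (k : ℤ) (p : Config d × Fin d) :
    exchange k p = (Function.update p.1 k p.2, p.1 k) := rfl

/-- The matrix `x` acting at site `k` on functions of the configuration:
`(x⁽ᵏ⁾ ψ)(σ) = ∑ⱼ x_{σ(k), j} ψ(σ with σ(k) replaced by j)`. -/
def siteFun {d : ℕ} (k : ℤ) (x : Matrix (Fin d) (Fin d) ℂ) (ψ : Config d → ℂ) : Config d → ℂ :=
  fun σ => ∑ j, x (σ k) j * ψ (Function.update σ k j)

theorem summable_sq {d : ℕ} (ψ : ConfigSpace d) : Summable fun σ => ‖ψ σ‖ ^ 2 := by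
  have h := (lp.memℓp ψ).summable (by norm_num)
  simpa using h

theorem norm_sq_eq {d : ℕ} (ψ : ConfigSpace d) : ‖ψ‖ ^ 2 = ∑' σ, ‖ψ σ‖ ^ 2 := by
  have h := lp.norm_rpow_eq_tsum (p := 2) (by norm_num) ψ
  simpa using h

theorem summable_fst {d : ℕ} (ψ : ConfigSpace d) :
    Summable fun p : Config d × Fin d => ‖ψ p.1‖ ^ 2 := by
  rw [summable_prod_of_nonneg (fun p => by positivity)]
  refine ⟨fun σ => Summable.of_finite, ?_⟩
  simpa [tsum_fintype] using (summable_sq ψ).mul_left (d : ℝ)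

theorem summable_update {d : ℕ} (k : ℤ) (ψ : ConfigSpace d) :
    Summable fun p : Config d × Fin d => ‖ψ (Function.update p.1 k p.2)‖ ^ 2 :=
  ((exchange k).summable_iff (f := fun p : Config d × Fin d => ‖ψ p.1‖ ^ 2)).2 (summable_fst ψ)

theorem tsum_update {d : ℕ} (k : ℤ) (ψ : ConfigSpace d) :
    ∑' σ, ∑ j, ‖ψ (Function.update σ k j)‖ ^ 2 = d * ‖ψ‖ ^ 2 := by
  have h1 := (summable_update k ψ).tsum_prod
  have h2 := (summable_fst ψ).tsum_prod
  have h3 := (exchange k).tsum_eq (fun p : Config d × Fin d => ‖ψ p.1‖ ^ 2)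
  simp only [exchange_apply] at h3
  simp only [tsum_fintype] at h1 h2
  rw [← h1, h3, h2, norm_sq_eq, ← tsum_mul_left]
  simp

theorem summable_update_sum {d : ℕ} (k : ℤ) (ψ : ConfigSpace d) :
    Summable fun σ => ∑ j, ‖ψ (Function.update σ k j)‖ ^ 2 := by
  simpa [tsum_fintype] using (summable_update k ψ).prod

theorem siteFun_sq_le {d : ℕ} (k : ℤ) (x : Matrix (Fin d) (Fin d) ℂ) (ψ : Config d → ℂ)
    (σ : Config d) :
    ‖siteFun k x ψ σ‖ ^ 2 ≤
      (∑ i, ∑ j, ‖x i j‖ ^ 2) * ∑ j, ‖ψ (Function.update σ k j)‖ ^ 2 := by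
  have h1 : ‖siteFun k x ψ σ‖ ≤ ∑ j, ‖x (σ k) j‖ * ‖ψ (Function.update σ k j)‖ := by
    refine (norm_sum_le _ _).trans (le_of_eq ?_)
    simp
  have h2 : ∑ j, ‖x (σ k) j‖ ^ 2 ≤ ∑ i, ∑ j, ‖x i j‖ ^ 2 :=
    Finset.single_le_sum (f := fun i => ∑ j, ‖x i j‖ ^ 2)
      (fun i _ => Finset.sum_nonneg fun j _ => by positivity) (Finset.mem_univ (σ k))
  calc ‖siteFun k x ψ σ‖ ^ 2
      ≤ (∑ j, ‖x (σ k) j‖ * ‖ψ (Function.update σ k j)‖) ^ 2 := by gcongr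
    _ ≤ (∑ j, ‖x (σ k) j‖ ^ 2) * ∑ j, ‖ψ (Function.update σ k j)‖ ^ 2 :=
        Finset.sum_mul_sq_le_sq_mul_sq _ _ _
    _ ≤ _ := by gcongr

theorem summable_siteFun {d : ℕ} (k : ℤ) (x : Matrix (Fin d) (Fin d) ℂ) (ψ : ConfigSpace d) :
    Summable fun σ => ‖siteFun k x ψ σ‖ ^ 2 :=
  Summable.of_nonneg_of_le (fun _ => by positivity) (fun σ => siteFun_sq_le k x ψ σ)
    ((summable_update_sum k ψ).mul_left _)

/-- The bounded operator `x⁽ᵏ⁾ = ⋯ ⊗ 𝟏 ⊗ x ⊗ 𝟏 ⊗ ⋯`, with `x` at site `k`. -/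
def siteOp {d : ℕ} (k : ℤ) (x : Matrix (Fin d) (Fin d) ℂ) :
    ConfigSpace d →L[ℂ] ConfigSpace d :=
  LinearMap.mkContinuous
    { toFun := fun ψ => ⟨siteFun k x ψ, memℓp_gen (by simpa using summable_siteFun k x ψ)⟩
      map_add' := fun ψ φ => by
        ext σ
        change siteFun k x (ψ + φ : ConfigSpace d) σ = siteFun k x ψ σ + siteFun k x φ σ
        simp [siteFun, mul_add, Finset.sum_add_distrib]
      map_smul' := fun c ψ => by
        ext σ
        simp [siteFun, Finset.mul_sum, mul_left_comm] }
    (Real.sqrt ((∑ i, ∑ j, ‖x i j‖ ^ 2) * d))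
    (fun ψ => by
      refine abs_le_of_sq_le_sq' ?_ (by positivity) |>.2
      rw [norm_sq_eq, mul_pow, Real.sq_sqrt (by positivity), mul_assoc, ← tsum_update k ψ,
        ← tsum_mul_left]
      exact (summable_siteFun k x ψ).tsum_le_tsum (fun σ => siteFun_sq_le k x ψ σ)
        ((summable_update_sum k ψ).mul_left _))

theorem siteOp_apply {d : ℕ} (k : ℤ) (x : Matrix (Fin d) (Fin d) ℂ) (ψ : ConfigSpace d)
    (σ : Config d) :
    siteOp k x ψ σ = ∑ j, x (σ k) j * ψ (Function.update σ k j) := rfl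

theorem siteOp_one {d : ℕ} (k : ℤ) : siteOp (d := d) k 1 = 1 := by
  ext ψ σ
  simp [siteOp_apply, Matrix.one_apply]

theorem siteOp_mul {d : ℕ} (k : ℤ) (x y : Matrix (Fin d) (Fin d) ℂ) :
    siteOp k (x * y) = siteOp k x * siteOp k y := by
  ext ψ σ
  simp only [siteOp_apply, mul_apply_eq_comp, Matrix.mul_apply, Finset.sum_mul,
    Finset.mul_sum, Function.update_self, Function.update_idem]
  rw [Finset.sum_comm]
  simp [mul_assoc]

theorem summable_siteOp_inner {d : ℕ} (k : ℤ) (x : Matrix (Fin d) (Fin d) ℂ)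
    (ψ φ : ConfigSpace d) :
    Summable fun p : Config d × Fin d =>
      (starRingEnd ℂ) (x (p.1 k) p.2 * ψ (Function.update p.1 k p.2)) * φ p.1 := by
  have hs := ((summable_update k ψ).add (summable_fst φ)).mul_left (∑ i, ∑ j, ‖x i j‖)
  refine Summable.of_norm_bounded hs fun p => ?_
  have h2 : ‖x (p.1 k) p.2‖ ≤ ∑ i, ∑ j, ‖x i j‖ :=
    (Finset.single_le_sum (f := fun j => ‖x (p.1 k) j‖) (fun _ _ => norm_nonneg _)
      (Finset.mem_univ p.2)).trans
    (Finset.single_le_sum (f := fun i => ∑ j, ‖x i j‖)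
      (fun i _ => Finset.sum_nonneg fun j _ => norm_nonneg _) (Finset.mem_univ (p.1 k)))
  have h3 : ‖ψ (Function.update p.1 k p.2)‖ * ‖φ p.1‖ ≤
      ‖ψ (Function.update p.1 k p.2)‖ ^ 2 + ‖φ p.1‖ ^ 2 := by
    nlinarith [sq_nonneg (‖ψ (Function.update p.1 k p.2)‖ - ‖φ p.1‖),
      sq_nonneg (‖ψ (Function.update p.1 k p.2)‖), sq_nonneg (‖φ p.1‖)]
  rw [norm_mul, RCLike.norm_conj, norm_mul, mul_assoc]
  gcongr

theorem siteOp_star {d : ℕ} (k : ℤ) (x : Matrix (Fin d) (Fin d) ℂ) :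
    siteOp k (star x) = star (siteOp k x) := by
  rw [ContinuousLinearMap.star_eq_adjoint, ContinuousLinearMap.eq_adjoint_iff]
  intro φ ψ
  have e1 : inner ℂ (siteOp k (star x) φ) ψ = ∑' p : Config d × Fin d,
      (starRingEnd ℂ) ((star x) (p.1 k) p.2 * φ (Function.update p.1 k p.2)) * ψ p.1 := by
    rw [(summable_siteOp_inner k (star x) φ ψ).tsum_prod, lp.inner_eq_tsum]
    refine tsum_congr fun σ => ?_
    rw [tsum_fintype, siteOp_apply, RCLike.inner_apply', map_sum, Finset.sum_mul]
  have e2 : inner ℂ φ (siteOp k x ψ) = ∑' p : Config d × Fin d,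
      (starRingEnd ℂ) ((starRingEnd ℂ) (x (p.1 k) p.2 * ψ (Function.update p.1 k p.2)) *
        φ p.1) := by
    rw [((Complex.hasSum_conj'.2 (summable_siteOp_inner k x ψ φ).hasSum).summable).tsum_prod,
      lp.inner_eq_tsum]
    refine tsum_congr fun σ => ?_
    rw [tsum_fintype, siteOp_apply, RCLike.inner_apply', Finset.mul_sum]
    refine Finset.sum_congr rfl fun j _ => ?_
    simp only [map_mul, Complex.conj_conj]
    ring
  rw [e1, e2, ← (exchange k).tsum_eq]
  refine tsum_congr fun p => ?_
  simp only [exchange_apply, Function.update_self, Function.update_idem, Function.update_eq_self,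
    Matrix.star_apply, map_mul, Complex.conj_conj, RCLike.star_def]
  ring

/-- The embedding `x ↦ x⁽ᵏ⁾` as a unital `*`-homomorphism into the bounded operators. -/
def siteHom (d : ℕ) (k : ℤ) :
    Matrix (Fin d) (Fin d) ℂ →⋆ₐ[ℂ] (ConfigSpace d →L[ℂ] ConfigSpace d) where
  toFun := siteOp k
  map_one' := siteOp_one k
  map_mul' := siteOp_mul k
  map_zero' := by
    ext ψ σ
    simp [siteOp_apply]
  map_add' x y := by
    ext ψ σ
    simp [siteOp_apply, add_mul, Finset.sum_add_distrib]
  commutes' c := by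
    ext ψ σ
    simp [siteOp_apply, Algebra.algebraMap_eq_smul_one, Matrix.one_apply]
  map_star' := siteOp_star k

/-! ### The quasi-local algebra -/

/-- The strictly local algebra of the sites `p, …, q`: the `*`-algebra generated by the one-site
operators there. It acts as `⨂_{p ≤ k ≤ q} M_d(ℂ)` tensored with the identity. -/
def localAlgebra (d : ℕ) (p q : ℤ) :
    StarSubalgebra ℂ (ConfigSpace d →L[ℂ] ConfigSpace d) :=
  StarAlgebra.adjoin ℂ {A | ∃ k ∈ Set.Icc p q, ∃ x, A = siteHom d k x}

/-- The quasi-local algebra: the norm completion (here: norm closure) of the union of the strictly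
local algebras. -/
def quasiLocal (d : ℕ) : StarSubalgebra ℂ (ConfigSpace d →L[ℂ] ConfigSpace d) :=
  (⨆ I : ℤ × ℤ, localAlgebra d I.1 I.2).topologicalClosure

instance isClosed_quasiLocal (d : ℕ) :
    IsClosed (quasiLocal d : Set (ConfigSpace d →L[ℂ] ConfigSpace d)) :=
  StarSubalgebra.isClosed_topologicalClosure _

/-- The quasi-local algebra as a type; it is a unital `C*`-algebra. -/
def QuasiLocal (d : ℕ) : Type := quasiLocal d

instance (d : ℕ) : CStarAlgebra (QuasiLocal d) :=
  inferInstanceAs (CStarAlgebra (quasiLocal d))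

/-- The inclusion of the quasi-local algebra into the bounded operators. -/
def toOp (d : ℕ) : QuasiLocal d →⋆ₐ[ℂ] (ConfigSpace d →L[ℂ] ConfigSpace d) where
  toFun a := Subtype.val (p := (· ∈ quasiLocal d)) a
  map_one' := rfl
  map_mul' _ _ := rfl
  map_zero' := rfl
  map_add' _ _ := rfl
  commutes' _ := rfl
  map_star' _ := rfl

theorem toOp_mem {d : ℕ} (a : QuasiLocal d) : toOp d a ∈ quasiLocal d := Subtype.property a

theorem toOp_injective (d : ℕ) : Function.Injective (toOp d) :=
  fun _ _ hab => Subtype.ext hab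

theorem norm_toOp {d : ℕ} (a : QuasiLocal d) : ‖toOp d a‖ = ‖a‖ := rfl

/-- A `*`-homomorphism into the bounded operators with values in the quasi-local algebra. -/
def corestrict {d : ℕ} {A : Type} [Semiring A] [Algebra ℂ A] [Star A]
    (f : A →⋆ₐ[ℂ] (ConfigSpace d →L[ℂ] ConfigSpace d)) (hf : ∀ x, f x ∈ quasiLocal d) :
    A →⋆ₐ[ℂ] QuasiLocal d where
  toFun x := (⟨f x, hf x⟩ : quasiLocal d)
  map_one' := toOp_injective d (map_one f)
  map_mul' x y := toOp_injective d (map_mul f x y)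
  map_zero' := toOp_injective d (map_zero f)
  map_add' x y := toOp_injective d (map_add f x y)
  commutes' c := toOp_injective d (AlgHomClass.commutes f c)
  map_star' x := toOp_injective d (map_star f x)

theorem toOp_corestrict {d : ℕ} {A : Type} [Semiring A] [Algebra ℂ A] [Star A]
    (f : A →⋆ₐ[ℂ] (ConfigSpace d →L[ℂ] ConfigSpace d)) (hf : ∀ x, f x ∈ quasiLocal d) (x : A) :
    toOp d (corestrict f hf x) = f x := rfl

theorem siteHom_mem (d : ℕ) (k : ℤ) (x : Matrix (Fin d) (Fin d) ℂ) :
    siteHom d k x ∈ quasiLocal d :=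
  StarSubalgebra.le_topologicalClosure _
    (le_iSup (fun I : ℤ × ℤ => localAlgebra d I.1 I.2) (k, k)
      (StarAlgebra.subset_adjoin ℂ _ ⟨k, by simp, x, rfl⟩))

/-- The embedding `x ↦ x⁽ᵏ⁾` of `M_d(ℂ)` into the quasi-local algebra at site `k`. -/
def site (d : ℕ) (k : ℤ) : Matrix (Fin d) (Fin d) ℂ →⋆ₐ[ℂ] QuasiLocal d :=
  corestrict (siteHom d k) (siteHom_mem d k)

/-- `O` has support in `[p, q]`: it commutes with all one-site operators outside `[p, q]`. -/
def IsSupportedIn {d : ℕ} (O : QuasiLocal d) (p q : ℤ) : Prop :=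
  ∀ k : ℤ, k ∉ Set.Icc p q → ∀ x, Commute O (site d k x)

/-! ### Translations -/

/-- The shift of configurations, `σ ↦ (j ↦ σ (j + 1))`. -/
def shiftConfig (d : ℕ) : Config d ≃ Config d where
  toFun σ := fun j => σ (j + 1)
  invFun σ := fun j => σ (j - 1)
  left_inv σ := by
    funext j
    simp
  right_inv σ := by
    funext j
    simp

theorem memlp_comp {d : ℕ} (e : Config d ≃ Config d) (ψ : ConfigSpace d) :
    Memℓp (fun σ => ψ (e σ)) 2 :=
  memℓp_gen (by
    have hs := (e.summable_iff (f := fun σ => ‖ψ σ‖ ^ 2)).2 (summable_sq ψ)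
    simpa [Function.comp_def] using hs)

/-- The shift unitary on the configuration Hilbert space. -/
def shift (d : ℕ) : ConfigSpace d ≃ₗᵢ[ℂ] ConfigSpace d where
  toFun ψ := ⟨fun σ => ψ (shiftConfig d σ), memlp_comp _ ψ⟩
  invFun ψ := ⟨fun σ => ψ ((shiftConfig d).symm σ), memlp_comp _ ψ⟩
  map_add' _ _ := rfl
  map_smul' _ _ := rfl
  left_inv ψ := by
    ext σ
    simp
  right_inv ψ := by
    ext σ
    simp
  norm_map' ψ := by
    refine (sq_eq_sq₀ (norm_nonneg _) (norm_nonneg _)).1 ?_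
    rw [norm_sq_eq, norm_sq_eq]
    exact (shiftConfig d).tsum_eq (fun σ => ‖ψ σ‖ ^ 2)

theorem shift_apply {d : ℕ} (ψ : ConfigSpace d) (σ : Config d) :
    shift d ψ σ = ψ (shiftConfig d σ) := rfl

theorem shift_symm_apply {d : ℕ} (ψ : ConfigSpace d) (σ : Config d) :
    (shift d).symm ψ σ = ψ ((shiftConfig d).symm σ) := rfl

/-- Conjugation of bounded operators by the shift unitary. -/
def shiftConj (d : ℕ) :
    (ConfigSpace d →L[ℂ] ConfigSpace d) →⋆ₐ[ℂ] (ConfigSpace d →L[ℂ] ConfigSpace d) :=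
  (shift d).conjStarAlgEquiv.toStarAlgHom

theorem shiftConj_apply (d : ℕ) (A : ConfigSpace d →L[ℂ] ConfigSpace d) (ψ : ConfigSpace d) :
    shiftConj d A ψ = shift d (A ((shift d).symm ψ)) := rfl

theorem continuous_shiftConj (d : ℕ) : Continuous (shiftConj d) :=
  (shift d).toContinuousLinearEquiv.conjContinuousAlgEquiv.continuous

theorem shiftConj_siteHom (d : ℕ) (k : ℤ) (x : Matrix (Fin d) (Fin d) ℂ) :
    shiftConj d (siteHom d k x) = siteHom d (k + 1) x := by
  ext ψ σ
  change ∑ j, x (σ (k + 1)) j *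
      ψ ((shiftConfig d).symm (Function.update (shiftConfig d σ) k j)) =
    ∑ j, x (σ (k + 1)) j * ψ (Function.update σ (k + 1) j)
  refine Finset.sum_congr rfl fun j _ => ?_
  congr 2
  refine congrArg _ (funext fun i => ?_)
  by_cases hi : i = k + 1
  · subst hi
    simp [shiftConfig]
  · have hi' : i - 1 ≠ k := fun h => hi (by omega)
    simp [shiftConfig, hi, hi']

theorem shiftConj_mem (d : ℕ) (a : QuasiLocal d) :
    (shiftConj d).comp (toOp d) a ∈ quasiLocal d := by
  have hle : (⨆ I : ℤ × ℤ, localAlgebra d I.1 I.2) ≤ (quasiLocal d).comap (shiftConj d) := by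
    refine iSup_le fun I => StarAlgebra.adjoin_le ?_
    rintro A ⟨k, -, x, rfl⟩
    change shiftConj d (siteHom d k x) ∈ quasiLocal d
    rw [shiftConj_siteHom]
    exact siteHom_mem d (k + 1) x
  have hcl : IsClosed ((quasiLocal d).comap (shiftConj d) :
      Set (ConfigSpace d →L[ℂ] ConfigSpace d)) :=
    (isClosed_quasiLocal d).preimage (continuous_shiftConj d)
  exact StarSubalgebra.topologicalClosure_minimal hle hcl (toOp_mem a)

/-- The translation of the chain by one site, implemented by the shift unitary. -/
def translation (d : ℕ) : QuasiLocal d →⋆ₐ[ℂ] QuasiLocal d :=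
  corestrict ((shiftConj d).comp (toOp d)) (shiftConj_mem d)

theorem translation_site (d : ℕ) (k : ℤ) (x : Matrix (Fin d) (Fin d) ℂ) :
    translation d (site d k x) = site d (k + 1) x :=
  toOp_injective d (shiftConj_siteHom d k x)

/-! ### States -/

/-- A state: a positive, normalised linear functional. -/
structure IsState {d : ℕ} (ω : QuasiLocal d →ₗ[ℂ] ℂ) : Prop where
  nonneg : ∀ a, 0 ≤ ω (star a * a)
  map_one : ω 1 = 1

/-- Translation invariance of a functional. -/
def IsTranslationInvariant {d : ℕ} (ω : QuasiLocal d →ₗ[ℂ] ℂ) : Prop :=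
  ∀ a, ω (translation d a) = ω a

/-- Spatial `L¹`-clustering: `∑_ℓ |ω(x⁽⁰⁾ y⁽ˡ⁾) - ω(x⁽⁰⁾) ω(y⁽⁰⁾)| < ∞` for all one-site
operators. -/
def IsL1Clustering {d : ℕ} (ω : QuasiLocal d →ₗ[ℂ] ℂ) : Prop :=
  ∀ x y : Matrix (Fin d) (Fin d) ℂ,
    Summable fun l : ℤ => ‖ω (site d 0 x * site d l y) - ω (site d 0 x) * ω (site d 0 y)‖

/-! ### The mean-field dissipative dynamics of the sites `0, …, N - 1` -/

/-- `∑_{k=0}^{N-1} x⁽ᵏ⁾`. -/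
def siteSum {d : ℕ} (N : ℕ) (x : Matrix (Fin d) (Fin d) ℂ) : QuasiLocal d :=
  ∑ k ∈ Finset.range N, site d (k : ℤ) x

/-- The mean-field operator `(1/N) ∑_{k=0}^{N-1} x⁽ᵏ⁾`. -/
def meanField {d : ℕ} (N : ℕ) (x : Matrix (Fin d) (Fin d) ℂ) : QuasiLocal d :=
  (1 / (N : ℂ)) • siteSum N x

/-- The collective operator `(1/√N) ∑_{k=0}^{N-1} x⁽ᵏ⁾`. -/
def collective {d : ℕ} (N : ℕ) (x : Matrix (Fin d) (Fin d) ℂ) : QuasiLocal d :=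
  ((1 / Real.sqrt N : ℝ) : ℂ) • siteSum N x

/-- A Hermitian basis of `M_d(ℂ)`, orthonormal for the trace inner product. -/
structure IsHermitianONB {d : ℕ} (v : Fin (d ^ 2) → Matrix (Fin d) (Fin d) ℂ) : Prop where
  isHermitian : ∀ μ, (v μ).IsHermitian
  trace_mul : ∀ μ ν, (v μ * v ν).trace = if μ = ν then 1 else 0

/-- The linear term `∑_μ ε_μ ∑_k v_μ⁽ᵏ⁾` of the Hamiltonian. -/
def freeHamiltonian {d : ℕ} (v : Fin (d ^ 2) → Matrix (Fin d) (Fin d) ℂ) (ε : Fin (d ^ 2) → ℝ)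
    (N : ℕ) : QuasiLocal d :=
  ∑ μ, (ε μ : ℂ) • siteSum N (v μ)

/-- The mean-field term `∑_{μν} h_{μν} (1/N) (∑_k v_μ⁽ᵏ⁾) (∑_l v_ν⁽ˡ⁾)` of the Hamiltonian. -/
def meanFieldHamiltonian {d : ℕ} (v : Fin (d ^ 2) → Matrix (Fin d) (Fin d) ℂ)
    (h : Matrix (Fin (d ^ 2)) (Fin (d ^ 2)) ℂ) (N : ℕ) : QuasiLocal d :=
  ∑ μ, ∑ ν, (h μ ν * (1 / (N : ℂ))) • (siteSum N (v μ) * siteSum N (v ν))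

/-- Left multiplication by `a`. -/
def lmul {d : ℕ} (a : QuasiLocal d) : QuasiLocal d →L[ℂ] QuasiLocal d :=
  ContinuousLinearMap.mul ℂ (QuasiLocal d) a

/-- Right multiplication by `a`. -/
def rmul {d : ℕ} (a : QuasiLocal d) : QuasiLocal d →L[ℂ] QuasiLocal d :=
  (ContinuousLinearMap.mul ℂ (QuasiLocal d)).flip a

/-- The Lindblad generator with Hamiltonian `freeHamiltonian + meanFieldHamiltonian` and Kossakowski
matrix `C`, as a bounded operator on the quasi-local algebra; see `generator_apply` for the
formula. -/
def generator {d : ℕ} (v : Fin (d ^ 2) → Matrix (Fin d) (Fin d) ℂ) (ε : Fin (d ^ 2) → ℝ)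
    (h C : Matrix (Fin (d ^ 2)) (Fin (d ^ 2)) ℂ) (N : ℕ) : QuasiLocal d →L[ℂ] QuasiLocal d :=
  Complex.I • (lmul (freeHamiltonian v ε N + meanFieldHamiltonian v h N)
      - rmul (freeHamiltonian v ε N + meanFieldHamiltonian v h N))
    + ∑ μ, ∑ ν, (C μ ν / 2) •
      ((rmul (collective N (v ν))).comp (lmul (collective N (v μ)) - rmul (collective N (v μ)))
        + (lmul (collective N (v μ))).comp
            (rmul (collective N (v ν)) - lmul (collective N (v ν))))

theorem generator_apply {d : ℕ} (v : Fin (d ^ 2) → Matrix (Fin d) (Fin d) ℂ)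
    (ε : Fin (d ^ 2) → ℝ) (h C : Matrix (Fin (d ^ 2)) (Fin (d ^ 2)) ℂ) (N : ℕ)
    (x : QuasiLocal d) :
    generator v ε h C N x =
      Complex.I • ⁅freeHamiltonian v ε N + meanFieldHamiltonian v h N, x⁆
        + ∑ μ, ∑ ν, (C μ ν / 2) •
          (⁅collective N (v μ), x⁆ * collective N (v ν)
            + collective N (v μ) * ⁅x, collective N (v ν)⁆) := by
  simp [generator, lmul, rmul, Ring.lie_def, mul_add, add_mul, mul_sub, sub_mul, mul_assoc]

/-- The dissipative dynamics `γ_t^{(N)} = exp(t 𝕃^{(N)})`. -/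
def dynamics {d : ℕ} (v : Fin (d ^ 2) → Matrix (Fin d) (Fin d) ℂ) (ε : Fin (d ^ 2) → ℝ)
    (h C : Matrix (Fin (d ^ 2)) (Fin (d ^ 2)) ℂ) (N : ℕ) (t : ℝ) :
    QuasiLocal d →L[ℂ] QuasiLocal d :=
  NormedSpace.exp ((t : ℂ) • generator v ε h C N)

/-! ### The limiting Hamiltonian and time-ordered exponentials -/

/-- The coefficients `B̃ = (C - Cᵀ)/2 + 2 i Re h`. -/
def couplingB {n : ℕ} (h C : Matrix (Fin n) (Fin n) ℂ) (μ ν : Fin n) : ℂ :=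
  (C μ ν - C ν μ) / 2 + 2 * Complex.I * ((h μ ν).re : ℂ)

/-- The time-dependent Hamiltonian
`H(t) = -i ∑_{k=0}^{S-1} ∑_μ (∑_ν B̃_{μν} m_ν(t) + i ε_μ) v_μ⁽ᵏ⁾` of the first `S` sites, for given
macroscopic averages `m_ν(t)`. -/
def limitHamiltonian {d : ℕ} (v : Fin (d ^ 2) → Matrix (Fin d) (Fin d) ℂ) (ε : Fin (d ^ 2) → ℝ)
    (h C : Matrix (Fin (d ^ 2)) (Fin (d ^ 2)) ℂ) (S : ℕ) (m : Fin (d ^ 2) → ℝ → ℝ) (t : ℝ) :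
    QuasiLocal d :=
  (-Complex.I) • ∑ k ∈ Finset.range S, ∑ μ,
    ((∑ ν, couplingB h C μ ν * (m ν t : ℂ)) + Complex.I * (ε μ : ℂ)) • site d (k : ℤ) (v μ)

/-- The iterated integral
`∫_0^t ds₁ ∫_0^{s₁} ds₂ ⋯ ∫_0^{s_{n-1}} ds_n H(s₁) H(s₂) ⋯ H(s_n)`. -/
def dysonTerm {d : ℕ} (H : ℝ → QuasiLocal d) : ℕ → ℝ → QuasiLocal d
  | 0, _ => 1
  | n + 1, t => ∫ s in (0 : ℝ)..t, H s * dysonTerm H n s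

/-- The time-ordered exponential `𝕋 exp(-i ∫_0^t H(s) ds)`, defined by its Dyson series. -/
def timeOrderedExp {d : ℕ} (H : ℝ → QuasiLocal d) (t : ℝ) : QuasiLocal d :=
  ∑' n, (-Complex.I) ^ n • dysonTerm H n t

end SpinChain

end

/-!
The generator `𝕃^{(N)}` is a function of the collective operators of the sites `0, …, N - 1`. Ordering
these to the right and centring the averages `(1/N) ∑_k v_ν⁽ᵏ⁾` at numbers `m_ν` gives
(`generator_eq`)

  `𝕃 x = ∑_μ c_μ(m) [∑_k v_μ⁽ᵏ⁾, x] + ∑_{μν} B̃_{μν} [∑_k v_μ⁽ᵏ⁾, x] Y_ν + (1/N) (double commutators)`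

with the fluctuations `Y_ν = (1/N) ∑_k v_ν⁽ᵏ⁾ - m_ν` and `c_μ(m) = ∑_ν B̃_{μν} m_ν + i ε_μ`. The
first term is the commutator with the limiting Hamiltonian, and on an element with bounded support
the double commutators are bounded uniformly in `N`. So everything rests on a law of large numbers
at time `t`: the fluctuations must vanish in the states `ω(c* γ_t[·] c)`.

The numbers `m_ν(t)` solve the mean-field equations `m' = F(m)` obtained by applying `𝕃` to the
averages and dropping fluctuations. They are a polynomial system with the conserved quantity
`∑_ν m_ν²`, because the structure constants of an orthonormal Hermitian basis are antisymmetric, and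
therefore have a global bounded real solution (`exists_meanField_solution`).

The maps `γ_t` are positive: `𝕃 x = G* x + x G + Φ x` with a positive map `Φ`, and
`x ↦ G* x + x G + κ⁻¹ G* x G` equals `κ⁻¹ (κ + G)* x (κ + G) - κ x`, whose exponential is positive
(`exp_lindblad_nonneg`, `dynamics_nonneg`). Hence `φ ∘ γ_t` satisfies the Cauchy–Schwarz inequality
for each positive functional `φ`, with total mass `φ(1)`. The equation for `m` is chosen so that the
terms of first order in `𝕃(Y_ν²) + ∂_t(Y_ν²)` cancel (`generator_fluctuation_sq`); the remaining
terms are quadratic in `Y` or of order `1/N`, and Grönwall's inequality for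
`∑_ν φ(γ_t[Y_ν²])` propagates the law of large numbers from time `0` to time `t`
(`exists_fluctuationSize_le`). At time `0` it follows from clustering (`norm_covariance_le`), also
for the functionals `ω(c* · c)`, as averages asymptotically commute with `c`
(`tendsto_gnsNorm_meanField_sub`).

The Dyson series solves `U' = -i H U`, so `U` is unitary, and the propagators of larger systems differ
from those of smaller ones by commuting factors. Conjugation by `U^{(S)}_t` is thus eventually
constant in `S` on elements with bounded support, and its limit is the automorphism `α_t`
(`exists_limit_automorphism`). The derivative of the interpolation
`s ↦ φ(γ_s[U_s (U_t* O U_t) U_s*])` between `φ(α_t[O])` and `φ(γ_t[O])` contains only the fluctuation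
term and the terms of order `1/N`, which gives the convergence for such `O`
(`tendsto_dynamics_of_isSupportedBelow`). Density and polarization of `ω(a · b)` in terms of the
functionals `ω(c* · c)` give it in general.
-/

noncomputable section

namespace SpinChain

/-! ### Positivity of quantum dynamical semigroups -/

section Positivity

variable {A : Type*} [CStarAlgebra A] [PartialOrder A] [StarOrderedRing A]

theorem exp_apply_nonneg {T : A →L[ℂ] A} (hT : ∀ x, 0 ≤ x → 0 ≤ T x) {x : A} (hx : 0 ≤ x) :
    0 ≤ NormedSpace.exp T x := by
  have hpow : ∀ n : ℕ, 0 ≤ (T ^ n) x := by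
    intro n
    induction n with
    | zero => simpa using hx
    | succ n ih => rw [pow_succ']; exact hT _ ih
  have hs := NormedSpace.exp_series_hasSum_exp' (𝕂 := ℝ) T
  have hs' := hs.mapL (ContinuousLinearMap.apply ℂ A x)
  refine hs'.nonneg fun n => ?_
  simp only [ContinuousLinearMap.apply_apply, smul_apply]
  exact smul_nonneg (by positivity) (hpow n)

theorem exp_sub_smul_one {A : Type*} [CStarAlgebra A] (T : A →L[ℂ] A) (r : ℂ) :
    NormedSpace.exp (T - r • (1 : A →L[ℂ] A)) = Complex.exp (-r) • NormedSpace.exp T := by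
  let +nondep : NormedAlgebra ℚ (A →L[ℂ] A) := .restrictScalars ℚ ℂ _
  have h1 : Commute T ((-r) • (1 : A →L[ℂ] A)) := by
    ext y
    simp
  have h2 : NormedSpace.exp ((-r) • (1 : A →L[ℂ] A)) = Complex.exp (-r) • (1 : A →L[ℂ] A) := by
    have := NormedSpace.algebraMap_exp_comm (𝕂 := ℂ) (𝔸 := A →L[ℂ] A) (-r)
    rw [Algebra.algebraMap_eq_smul_one, Algebra.algebraMap_eq_smul_one] at this
    rw [← this, Complex.exp_eq_exp_ℂ]
  have h3 : T - r • (1 : A →L[ℂ] A) = T + (-r) • (1 : A →L[ℂ] A) := by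
    ext y
    simp [sub_eq_add_neg]
  rw [h3, NormedSpace.exp_add_of_commute h1, h2]
  ext y
  simp

/-- A generator `x ↦ G* x + x G + Φ x` with `Φ` positive generates a semigroup of positive maps.
Adding `κ⁻¹ G* x G` turns it into `κ⁻¹ (κ + G)* x (κ + G) + Φ x - κ x`, a positive map up to a
multiple of the identity, and the correction disappears for `κ → ∞`. -/
theorem exp_lindblad_nonneg {G : A} {Φ L : A →L[ℂ] A} (hΦ : ∀ x, 0 ≤ x → 0 ≤ Φ x)
    (hL : ∀ x, L x = star G * x + x * G + Φ x) {t : ℝ} (ht : 0 ≤ t) {x : A} (hx : 0 ≤ x) :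
    0 ≤ NormedSpace.exp ((t : ℂ) • L) x := by
  let +nondep : NormedAlgebra ℚ (A →L[ℂ] A) := .restrictScalars ℚ ℂ _
  set J : A →L[ℂ] A := (ContinuousLinearMap.mul ℂ A (star G)).comp
    ((ContinuousLinearMap.mul ℂ A).flip G) with hJ
  have hJx : ∀ y, J y = star G * (y * G) := fun y => rfl
  have hlim : Tendsto (fun κ : ℝ => NormedSpace.exp ((t : ℂ) • (L + ((κ⁻¹ : ℝ) : ℂ) • J)) x) atTop
      (𝓝 (NormedSpace.exp ((t : ℂ) • L) x)) := by
    have h0 : Tendsto (fun κ : ℝ => ((κ⁻¹ : ℝ) : ℂ)) atTop (𝓝 ((0 : ℝ) : ℂ)) :=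
      (Complex.continuous_ofReal.tendsto 0).comp tendsto_inv_atTop_zero
    have h1 : Tendsto (fun κ : ℝ => (t : ℂ) • (L + ((κ⁻¹ : ℝ) : ℂ) • J)) atTop
        (𝓝 ((t : ℂ) • (L + ((0 : ℝ) : ℂ) • J))) :=
      (tendsto_const_nhds.add (h0.smul_const J)).const_smul _
    have h3 : L + ((0 : ℝ) : ℂ) • J = L := by
      ext y
      simp
    rw [h3] at h1
    have h2 := ((NormedSpace.exp_continuous (𝔸 := A →L[ℂ] A)).tendsto _).comp h1
    exact ((ContinuousLinearMap.apply ℂ A x).continuous.tendsto _).comp h2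
  refine ge_of_tendsto hlim ?_
  filter_upwards [eventually_gt_atTop 0] with κ hκ
  have hκ' : (κ : ℂ) ≠ 0 := by exact_mod_cast hκ.ne'
  set T : A →L[ℂ] A := (t : ℂ) • (L + ((κ⁻¹ : ℝ) : ℂ) • J) + ((t * κ : ℝ) : ℂ) • (1 : A →L[ℂ] A)
    with hTdef
  have hT : ∀ y, 0 ≤ y → 0 ≤ T y := by
    intro y hy
    have e : T y =
        t • (κ⁻¹ • (star ((κ : ℂ) • (1 : A) + G) * y * ((κ : ℂ) • (1 : A) + G)) + Φ y) := by
      have e1 : star ((κ : ℂ) • (1 : A) + G) * y * ((κ : ℂ) • (1 : A) + G)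
          = ((κ : ℂ) * κ) • y + (κ : ℂ) • (star G * y + y * G) + star G * (y * G) := by
        simp only [star_add, star_smul, star_one, add_mul, mul_add, smul_mul_assoc, one_mul,
          mul_smul_comm, mul_one, RCLike.star_def, Complex.conj_ofReal, mul_assoc, smul_add,
          smul_smul]
        abel
      rw [e1]
      simp only [hTdef, add_apply, smul_apply, one_apply_eq_self, hL, hJx, ← Complex.coe_smul,
        smul_add, smul_smul, Complex.ofReal_mul, Complex.ofReal_inv]
      field_simp
      abel
    rw [e]
    refine smul_nonneg ht (add_nonneg (smul_nonneg (by positivity) ?_) (hΦ y hy))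
    exact star_left_conjugate_nonneg hy _
  have e : (t : ℂ) • (L + ((κ⁻¹ : ℝ) : ℂ) • J) = T - ((t * κ : ℝ) : ℂ) • (1 : A →L[ℂ] A) := by
    simp [hTdef]
  rw [e, exp_sub_smul_one, smul_apply, ← Complex.ofReal_neg, ← Complex.ofReal_exp,
    Complex.coe_smul]
  exact smul_nonneg (Real.exp_nonneg _) (exp_apply_nonneg hT hx)

end Positivity

/-! ### Positive functionals -/

section Functional

variable {A : Type*} [CStarAlgebra A] [PartialOrder A] [StarOrderedRing A]

/-- The seminorm `‖y‖_φ = φ(y* y)^{1/2}` of the GNS construction of a positive functional. -/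
def gnsNorm (φ : A →ₚ[ℂ] ℂ) (y : A) : ℝ := ‖φ.toPreGNS y‖

theorem gnsNorm_nonneg (φ : A →ₚ[ℂ] ℂ) (y : A) : 0 ≤ gnsNorm φ y := norm_nonneg _

theorem gnsNorm_sq (φ : A →ₚ[ℂ] ℂ) (y : A) : ((gnsNorm φ y ^ 2 : ℝ) : ℂ) = φ (star y * y) := by
  have := φ.preGNS_norm_sq (φ.toPreGNS y)
  simpa [gnsNorm] using this

theorem gnsNorm_sq_re (φ : A →ₚ[ℂ] ℂ) (y : A) : gnsNorm φ y ^ 2 = (φ (star y * y)).re := by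
  rw [← gnsNorm_sq, Complex.ofReal_re]

theorem gnsNorm_add_le (φ : A →ₚ[ℂ] ℂ) (x y : A) :
    gnsNorm φ (x + y) ≤ gnsNorm φ x + gnsNorm φ y := by
  simpa [gnsNorm] using norm_add_le (φ.toPreGNS x) (φ.toPreGNS y)

/-- The Cauchy–Schwarz inequality for a positive functional. -/
theorem norm_apply_star_mul_le (φ : A →ₚ[ℂ] ℂ) (x y : A) :
    ‖φ (star x * y)‖ ≤ gnsNorm φ x * gnsNorm φ y :=
  norm_inner_le_norm (𝕜 := ℂ) (φ.toPreGNS x) (φ.toPreGNS y)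

theorem gnsNorm_mul_le (φ : A →ₚ[ℂ] ℂ) (x y : A) : gnsNorm φ (x * y) ≤ ‖x‖ * gnsNorm φ y := by
  have h := (φ.leftMulMapPreGNS x).le_opNorm (φ.toPreGNS y)
  refine h.trans ?_
  exact mul_le_mul_of_nonneg_right (LinearMap.mkContinuous_norm_le _ (norm_nonneg x) _)
    (norm_nonneg _)

theorem gnsNorm_one_sq (φ : A →ₚ[ℂ] ℂ) : gnsNorm φ 1 ^ 2 = (φ 1).re := by
  simp [gnsNorm_sq_re]

theorem gnsNorm_le (φ : A →ₚ[ℂ] ℂ) (x : A) : gnsNorm φ x ≤ ‖x‖ * gnsNorm φ 1 := by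
  simpa using gnsNorm_mul_le φ x 1

theorem norm_apply_le_gnsNorm (φ : A →ₚ[ℂ] ℂ) (x : A) : ‖φ x‖ ≤ gnsNorm φ 1 * gnsNorm φ x := by
  simpa using norm_apply_star_mul_le φ 1 x

theorem norm_apply_le_norm (φ : A →ₚ[ℂ] ℂ) (x : A) : ‖φ x‖ ≤ (φ 1).re * ‖x‖ := by
  refine (norm_apply_le_gnsNorm φ x).trans ?_
  rw [← gnsNorm_one_sq]
  nlinarith [gnsNorm_le φ x, gnsNorm_nonneg φ 1]

/-- A positive functional as a continuous linear map. -/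
def functionalCLM (φ : A →ₚ[ℂ] ℂ) : A →L[ℂ] ℂ :=
  LinearMap.mkContinuous (φ : A →ₗ[ℂ] ℂ) (φ 1).re (norm_apply_le_norm φ)

theorem norm_apply_mul_mul_le (φ : A →ₚ[ℂ] ℂ) {x : A} (hx : IsSelfAdjoint x) (q y : A) :
    ‖φ (x * q * y)‖ ≤ ‖q‖ * (gnsNorm φ x * gnsNorm φ y) := by
  have h := norm_apply_star_mul_le φ x (q * y)
  rw [hx.star_eq, ← mul_assoc] at h
  refine h.trans ?_
  nlinarith [gnsNorm_mul_le φ q y, gnsNorm_nonneg φ x]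

theorem norm_apply_mul_le (φ : A →ₚ[ℂ] ℂ) (q y : A) :
    ‖φ (q * y)‖ ≤ ‖q‖ * (gnsNorm φ 1 * gnsNorm φ y) := by
  simpa using norm_apply_mul_mul_le φ (IsSelfAdjoint.one A) q y

/-- A positive functional precomposed with a positive map. -/
def functionalComp (φ : A →ₚ[ℂ] ℂ) (T : A →L[ℂ] A) (hT : ∀ x, 0 ≤ x → 0 ≤ T x) : A →ₚ[ℂ] ℂ :=
  PositiveLinearMap.mk₀ ((φ : A →ₗ[ℂ] ℂ) ∘ₗ (T : A →ₗ[ℂ] A))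
    (fun x hx => φ.map_nonneg (hT x hx))

/-- The positive functional `x ↦ φ(c* x c)`. -/
def functionalConj (φ : A →ₚ[ℂ] ℂ) (c : A) : A →ₚ[ℂ] ℂ :=
  PositiveLinearMap.mk₀ ((φ : A →ₗ[ℂ] ℂ) ∘ₗ LinearMap.mulLeft ℂ (star c) ∘ₗ LinearMap.mulRight ℂ c)
    (fun x hx => by
      have := φ.map_nonneg (star_left_conjugate_nonneg hx c)
      simpa [mul_assoc] using this)

theorem functionalConj_apply (φ : A →ₚ[ℂ] ℂ) (c x : A) :
    functionalConj φ c x = φ (star c * (x * c)) := rfl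

end Functional

/-! ### Global solutions of norm-preserving differential equations -/

/-- A bounded Lipschitz vector field has a global integral curve through each point. -/
theorem exists_integralCurve_of_lipschitz {E : Type*} [NormedAddCommGroup E] [NormedSpace ℝ E]
    [CompleteSpace E] {G : E → E} {K M : NNReal} (hK : LipschitzWith K G) (hM : ∀ x, ‖G x‖ ≤ M)
    (x₀ : E) : ∃ m : ℝ → E, m 0 = x₀ ∧ ∀ t, HasDerivAt m (G (m t)) t := by
  have key : ∀ T : NNReal, ∃ α : ℝ → E, α 0 = x₀ ∧
      ∀ t ∈ Set.Ioo (-T : ℝ) T, HasDerivAt α (G (α t)) t := by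
    intro T
    have h0 : (0 : ℝ) ∈ Set.Icc (-T : ℝ) T := by simp
    have hpl : IsPicardLindelof (fun _ => G) (⟨0, h0⟩ : Set.Icc (-T : ℝ) T) x₀ (M * T) 0 M K :=
      IsPicardLindelof.of_time_independent (fun x _ => hM x) hK.lipschitzOnWith (by simp)
    obtain ⟨α, hα0, hα⟩ := hpl.exists_eq_forall_mem_Icc_hasDerivWithinAt₀
    exact ⟨α, hα0, fun t ht =>
      (hα t (Set.Ioo_subset_Icc_self ht)).hasDerivAt (Icc_mem_nhds ht.1 ht.2)⟩
  choose α hα0 hα using key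
  let R : ℝ → NNReal := fun t => ⟨|t| + 1, by positivity⟩
  have hR : ∀ t, (R t : ℝ) = |t| + 1 := fun t => rfl
  have hglue : ∀ (T : NNReal) (t : ℝ), t ∈ Set.Ioo (-T : ℝ) T → α (R t) t = α T t := by
    intro T t ht
    have hT : (0 : ℝ) < T := by linarith [ht.1, ht.2]
    have hS : ∀ s : ℝ, s ∈ Set.Ioo (-(min (R t : ℝ) T)) (min (R t : ℝ) T) →
        s ∈ Set.Ioo (-(R t : ℝ)) (R t) ∧ s ∈ Set.Ioo (-T : ℝ) T := by
      rintro s ⟨h1, h2⟩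
      have h3 := min_le_left (R t : ℝ) T
      have h4 := min_le_right (R t : ℝ) T
      exact ⟨⟨by linarith, by linarith⟩, ⟨by linarith, by linarith⟩⟩
    have h0 : 0 < min (R t : ℝ) T := lt_min (by rw [hR]; positivity) hT
    refine ODE_solution_unique_of_mem_Ioo (v := fun _ => G) (s := fun _ => Set.univ) (K := K)
      (t₀ := 0) (fun _ _ => hK.lipschitzOnWith) ⟨by linarith, h0⟩
      (fun s hs => ⟨hα _ s (hS s hs).1, trivial⟩) (fun s hs => ⟨hα _ s (hS s hs).2, trivial⟩)
      ((hα0 _).trans (hα0 _).symm) ?_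
    have h5 : |t| < min (R t : ℝ) T := lt_min (by rw [hR]; linarith) (abs_lt.2 ht)
    exact abs_lt.1 h5
  refine ⟨fun t => α (R t) t, hα0 _, fun t => ?_⟩
  have ht : t ∈ Set.Ioo (-(R t : ℝ)) (R t) := by
    rw [hR]
    exact abs_lt.1 (by linarith)
  refine (hα (R t) t ht).congr_of_eventuallyEq ?_
  filter_upwards [Ioo_mem_nhds ht.1 ht.2] with s hs using hglue _ s hs

/-- A smooth vector field orthogonal to the position vector has global integral curves, along which
the norm is constant. A cutoff makes the field bounded and Lipschitz without changing it on the
sphere that contains the curve. -/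
theorem exists_integralCurve_of_inner_eq_zero {E : Type*} [NormedAddCommGroup E]
    [InnerProductSpace ℝ E] [FiniteDimensional ℝ E] {F : E → E} (hF : ContDiff ℝ 1 F)
    (horth : ∀ x, inner ℝ x (F x) = 0) (x₀ : E) :
    ∃ m : ℝ → E, m 0 = x₀ ∧ (∀ t, HasDerivAt m (F (m t)) t) ∧ ∀ t, ‖m t‖ = ‖x₀‖ := by
  let χ : ContDiffBump (0 : E) := ⟨‖x₀‖ + 1, ‖x₀‖ + 2, by positivity, by linarith⟩
  let G : E → E := fun x => χ x • F x
  have hG : ContDiff ℝ 1 G := (χ.contDiff).smul hF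
  have hGc : HasCompactSupport G := χ.hasCompactSupport.smul_right
  obtain ⟨K, hK⟩ := hG.lipschitzWith_of_hasCompactSupport hGc one_ne_zero
  obtain ⟨M, hM⟩ := hGc.exists_bound_of_continuous hG.continuous
  obtain ⟨m, hm0, hm⟩ := exists_integralCurve_of_lipschitz (M := ⟨max M 0, le_max_right _ _⟩) hK
    (fun x => (hM x).trans (le_max_left _ _)) x₀
  have hsq : ∀ t, HasDerivAt (fun s => inner ℝ (m s) (m s)) 0 t := by
    intro t
    have := (hm t).inner ℝ (hm t)
    have e : inner ℝ (m t) (G (m t)) = 0 := by simp [G, inner_smul_right, horth]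
    rwa [real_inner_comm (m t) (G (m t)), e, add_zero] at this
  have hnorm : ∀ t, ‖m t‖ = ‖x₀‖ := by
    intro t
    have := is_const_of_deriv_eq_zero (fun s => (hsq s).differentiableAt)
      (fun s => (hsq s).deriv) t 0
    simp only [real_inner_self_eq_norm_sq, hm0] at this
    exact (sq_eq_sq₀ (norm_nonneg _) (norm_nonneg _)).1 this
  refine ⟨m, hm0, fun t => ?_, hnorm⟩
  have h1 : χ (m t) = 1 := χ.one_of_mem_closedBall (by
    change m t ∈ Metric.closedBall 0 (‖x₀‖ + 1)
    rw [mem_closedBall_zero_iff, hnorm]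
    linarith)
  simpa [G, h1] using hm t

/-! ### Propagators of time-dependent Hamiltonians -/

/-- Uniqueness for the linear equation `Y' = a(t) Y` with bounded operators `a(t)`. -/
theorem linear_ode_unique {E : Type*} [NormedAddCommGroup E] [NormedSpace ℝ E]
    {a : ℝ → E →L[ℝ] E} (ha : Continuous a) {f g : ℝ → E}
    (hf : ∀ t, HasDerivAt f (a t (f t)) t) (hg : ∀ t, HasDerivAt g (a t (g t)) t)
    (h0 : f 0 = g 0) : f = g := by
  funext t
  obtain ⟨M, hM⟩ := (isCompact_Icc (a := -(|t| + 1)) (b := |t| + 1)).exists_bound_of_continuousOn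
    ha.continuousOn
  refine ODE_solution_unique_of_mem_Ioo (v := fun s x => a s x) (s := fun _ => Set.univ)
    (K := M.toNNReal) (a := -(|t| + 1)) (b := |t| + 1) (t₀ := 0) (fun s hs => ?_)
    (by constructor <;> linarith [abs_nonneg t])
    (fun s _ => ⟨hf s, trivial⟩) (fun s _ => ⟨hg s, trivial⟩) h0 (abs_lt.1 (by linarith))
  refine ((a s).lipschitz.weaken ?_).lipschitzOnWith
  rw [← NNReal.coe_le_coe, coe_nnnorm]
  exact (hM s (Set.Ioo_subset_Icc_self hs)).trans (Real.le_coe_toNNReal M)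

section Propagator

variable {A : Type*} [CStarAlgebra A] {H U : ℝ → A}

/-- `U` is the propagator of `H` started at time `0`: the solution of `U' = -i H U`, `U(0) = 1`. -/
structure IsPropagator (H U : ℝ → A) : Prop where
  zero : U 0 = 1
  hasDerivAt : ∀ t, HasDerivAt U ((-Complex.I) • (H t * U t)) t

theorem continuous_mulLeft_smul (hH : Continuous H) (c : ℂ) :
    Continuous fun t => ContinuousLinearMap.mul ℝ A (c • H t) :=
  (ContinuousLinearMap.mul ℝ A).continuous.comp (hH.const_smul c)

theorem IsPropagator.unique {U' : ℝ → A} (hH : Continuous H) (hU : IsPropagator H U)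
    (hU' : IsPropagator H U') : U = U' := by
  refine linear_ode_unique (continuous_mulLeft_smul hH (-Complex.I)) (fun t => ?_) (fun t => ?_)
    (hU.zero.trans hU'.zero.symm)
  · have := hU.hasDerivAt t
    rwa [← smul_mul_assoc] at this
  · have := hU'.hasDerivAt t
    rwa [← smul_mul_assoc] at this

theorem IsPropagator.hasDerivAt_star (hU : IsPropagator H U) (hsa : ∀ t, IsSelfAdjoint (H t))
    (t : ℝ) : HasDerivAt (fun s => star (U s)) (Complex.I • (star (U t) * H t)) t := by
  have := (hU.hasDerivAt t).star
  simpa [star_smul, star_mul, (hsa t).star_eq] using this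

/-- Unitarity of the propagator. `U* U` has derivative zero, whereas `U U*` solves the linear
equation `X' = -i [H, X]`, of which the constant `1` is the other solution. -/
theorem IsPropagator.mem_unitary (hH : Continuous H) (hU : IsPropagator H U)
    (hsa : ∀ t, IsSelfAdjoint (H t)) (t : ℝ) : U t ∈ unitary A := by
  have hUd := hU.hasDerivAt
  have hUs := hU.hasDerivAt_star hsa
  constructor
  · have hd : ∀ s, HasDerivAt (fun r => star (U r) * U r) 0 s := by
      intro s
      refine ((hUs s).mul (hUd s)).congr_deriv ?_
      rw [smul_mul_assoc, mul_smul_comm, mul_assoc, neg_smul, add_neg_cancel]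
    have := is_const_of_deriv_eq_zero (fun s => (hd s).differentiableAt)
      (fun s => (hd s).deriv) t 0
    simpa [hU.zero] using this
  · have hd : ∀ s, HasDerivAt (fun r => U r * star (U r))
        ((-Complex.I) • H s * (U s * star (U s)) + (U s * star (U s)) * (Complex.I • H s)) s := by
      intro s
      refine ((hUd s).mul (hUs s)).congr_deriv ?_
      simp only [smul_mul_assoc, mul_smul_comm, mul_assoc]
    have huniq := linear_ode_unique
      (a := fun s => ContinuousLinearMap.mul ℝ A ((-Complex.I) • H s)
        + (ContinuousLinearMap.mul ℝ A).flip (Complex.I • H s))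
      ((continuous_mulLeft_smul hH _).add
        ((ContinuousLinearMap.mul ℝ A).flip.continuous.comp (hH.const_smul Complex.I)))
      (f := fun r => U r * star (U r)) (g := fun _ => 1) hd
      (fun s => (hasDerivAt_const s (1 : A)).congr_deriv (by simp))
      (by simp [hU.zero])
    exact congrFun huniq t

/-- Propagators of commuting Hamiltonians multiply. -/
theorem IsPropagator.mul {H' U' : ℝ → A} (hU : IsPropagator H U) (hU' : IsPropagator H' U')
    (hc : ∀ s, Commute (H' s) (U s)) :
    IsPropagator (fun s => H s + H' s) (fun s => U s * U' s) where
  zero := by simp [hU.zero, hU'.zero]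
  hasDerivAt t := by
    refine ((hU.hasDerivAt t).mul (hU'.hasDerivAt t)).congr_deriv ?_
    rw [smul_mul_assoc, mul_smul_comm, ← smul_add, add_mul, mul_assoc, ← mul_assoc (U t),
      ← (hc t).eq, mul_assoc]

end Propagator

/-! ### Dyson series -/

section Dyson

variable {d : ℕ} {H : ℝ → QuasiLocal d}

theorem continuous_dysonTerm (hH : Continuous H) (n : ℕ) : Continuous (dysonTerm H n) := by
  induction n with
  | zero => exact continuous_const
  | succ n ih =>
    exact intervalIntegral.continuous_primitive
      (fun a b => (hH.mul ih).intervalIntegrable a b) 0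

theorem hasDerivAt_dysonTerm_succ (hH : Continuous H) (n : ℕ) (t : ℝ) :
    HasDerivAt (dysonTerm H (n + 1)) (H t * dysonTerm H n t) t :=
  intervalIntegral.integral_hasDerivAt_right
    ((hH.mul (continuous_dysonTerm hH n)).intervalIntegrable _ _)
    ((hH.mul (continuous_dysonTerm hH n)).stronglyMeasurableAtFilter _ _)
    (hH.mul (continuous_dysonTerm hH n)).continuousAt

theorem dysonTerm_succ_zero (n : ℕ) : dysonTerm H (n + 1) 0 = 0 := by
  simp [dysonTerm]

/-- The factor `‖1‖` is at most `1`, and vanishes when the algebra is trivial (`d = 0`). -/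
theorem norm_dysonTerm_le {M T : ℝ} (hM : 0 ≤ M)
    (hHM : ∀ s, |s| ≤ T → ‖H s‖ ≤ M) (n : ℕ) :
    ∀ t, |t| ≤ T → ‖dysonTerm H n t‖ ≤ ‖(1 : QuasiLocal d)‖ * ((M * |t|) ^ n / n.factorial) := by
  induction n with
  | zero => intro t _; simp [dysonTerm]
  | succ n ih =>
    intro t ht
    have hle : ∀ s, s ∈ Set.uIoc 0 t → |s| ≤ |t| := by
      intro s hs
      rcases le_total 0 t with h | h
      · rw [Set.uIoc_of_le h] at hs
        rw [abs_of_pos hs.1, abs_of_nonneg h]; exact hs.2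
      · rw [Set.uIoc_of_ge h] at hs
        rw [abs_of_nonpos hs.2, abs_of_nonpos h]; linarith [hs.1]
    have hbound : ∀ s ∈ Set.uIoc 0 t, ‖H s * dysonTerm H n s‖ ≤
        ‖(1 : QuasiLocal d)‖ * (M ^ (n + 1) / n.factorial) * |s| ^ n := by
      intro s hs
      have hs' := hle s hs
      calc ‖H s * dysonTerm H n s‖ ≤ ‖H s‖ * ‖dysonTerm H n s‖ := norm_mul_le _ _
        _ ≤ M * (‖(1 : QuasiLocal d)‖ * ((M * |s|) ^ n / n.factorial)) :=
            mul_le_mul (hHM s (hs'.trans ht)) (ih s (hs'.trans ht)) (norm_nonneg _) hM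
        _ = _ := by rw [mul_pow]; ring
    have hint : |∫ s in (0 : ℝ)..t, |s| ^ n| = |t| ^ (n + 1) / (n + 1) := by
      rcases le_total 0 t with h | h
      · have e : ∫ s in (0 : ℝ)..t, |s| ^ n = ∫ s in (0 : ℝ)..t, s ^ n := by
          refine intervalIntegral.integral_congr fun s hs => ?_
          rw [Set.uIcc_of_le h] at hs
          simp only [abs_of_nonneg hs.1]
        have h0 : 0 ≤ t ^ (n + 1) / (n + 1 : ℝ) := by positivity
        rw [e, integral_pow, zero_pow (Nat.succ_ne_zero n), sub_zero, abs_of_nonneg h0,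
          abs_of_nonneg h]
      · have e : ∫ s in (0 : ℝ)..t, |s| ^ n = ∫ s in (0 : ℝ)..t, (-s) ^ n := by
          refine intervalIntegral.integral_congr fun s hs => ?_
          rw [Set.uIcc_of_ge h] at hs
          simp only [abs_of_nonpos hs.2]
        rw [e, intervalIntegral.integral_comp_neg (fun s => s ^ n), integral_pow, neg_zero,
          abs_of_nonpos h, zero_pow (Nat.succ_ne_zero n), zero_sub, neg_div, abs_neg,
          abs_of_nonneg (div_nonneg (pow_nonneg (by linarith) _) (by positivity))]
    calc ‖dysonTerm H (n + 1) t‖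
        ≤ |∫ s in (0 : ℝ)..t, ‖(1 : QuasiLocal d)‖ * (M ^ (n + 1) / n.factorial) * |s| ^ n| :=
          intervalIntegral.norm_integral_le_abs_of_norm_le
            ((MeasureTheory.ae_restrict_iff' measurableSet_uIoc).2
              (MeasureTheory.ae_of_all _ hbound))
            ((continuous_const.mul (continuous_abs.pow n)).intervalIntegrable _ _)
      _ = ‖(1 : QuasiLocal d)‖ * ((M * |t|) ^ (n + 1) / (n + 1).factorial) := by
          have h0 : 0 ≤ ‖(1 : QuasiLocal d)‖ * (M ^ (n + 1) / n.factorial) :=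
            mul_nonneg (norm_nonneg _) (div_nonneg (pow_nonneg hM _) (Nat.cast_nonneg _))
          rw [intervalIntegral.integral_const_mul, abs_mul, hint, abs_of_nonneg h0,
            Nat.factorial_succ, mul_pow]
          push_cast
          field_simp

theorem exists_bound_on (hH : Continuous H) (T : ℝ) :
    ∃ M, 0 ≤ M ∧ ∀ s, |s| ≤ T → ‖H s‖ ≤ M := by
  obtain ⟨M, hM⟩ := (isCompact_Icc (a := -T) (b := T)).exists_bound_of_continuousOn
    hH.continuousOn
  exact ⟨max M 0, le_max_right _ _, fun s hs => (hM s (abs_le.1 hs)).trans (le_max_left _ _)⟩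

theorem summable_norm_dysonTerm (hH : Continuous H) (t : ℝ) :
    Summable fun n => ‖dysonTerm H n t‖ := by
  obtain ⟨M, hM, hHM⟩ := exists_bound_on hH |t|
  exact Summable.of_nonneg_of_le (fun _ => norm_nonneg _)
    (fun n => norm_dysonTerm_le hM hHM n t le_rfl)
    ((Real.summable_pow_div_factorial (M * |t|)).mul_left _)

theorem timeOrderedExp_zero : timeOrderedExp H 0 = 1 := by
  rw [timeOrderedExp, tsum_eq_single 0]
  · simp [dysonTerm]
  · intro n hn
    obtain ⟨n, rfl⟩ := Nat.exists_eq_succ_of_ne_zero hn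
    rw [Nat.succ_eq_add_one, dysonTerm_succ_zero, smul_zero]

theorem summable_dyson (hH : Continuous H) (t : ℝ) :
    Summable fun n : ℕ => (-Complex.I) ^ n • dysonTerm H n t :=
  Summable.of_norm (by simpa [norm_smul] using summable_norm_dysonTerm hH t)

theorem hasDerivAt_timeOrderedExp (hH : Continuous H) (t : ℝ) :
    HasDerivAt (timeOrderedExp H) ((-Complex.I) • (H t * timeOrderedExp H t)) t := by
  obtain ⟨M, hM, hHM⟩ := exists_bound_on hH (|t| + 1)
  have hmem : ∀ s ∈ Set.Ioo (-(|t| + 1)) (|t| + 1), |s| ≤ |t| + 1 := fun s hs => (abs_lt.2 hs).le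
  have h0 : (0 : ℝ) ∈ Set.Ioo (-(|t| + 1)) (|t| + 1) := by
    constructor <;> linarith [abs_nonneg t]
  have ht : t ∈ Set.Ioo (-(|t| + 1)) (|t| + 1) := abs_lt.1 (by linarith)
  set u : ℕ → ℝ := fun n => M * (‖(1 : QuasiLocal d)‖ * ((M * (|t| + 1)) ^ n / n.factorial))
  have hu : Summable u := ((Real.summable_pow_div_factorial _).mul_left _).mul_left _
  have hd := hasDerivAt_tsum_of_isPreconnected (𝕜 := ℝ)
    (g := fun n s => (-Complex.I) ^ (n + 1) • dysonTerm H (n + 1) s)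
    (g' := fun n s => (-Complex.I) ^ (n + 1) • (H s * dysonTerm H n s))
    hu isOpen_Ioo isPreconnected_Ioo
    (fun n s _ => (hasDerivAt_dysonTerm_succ hH n s).const_smul ((-Complex.I) ^ (n + 1)))
    (fun n s hs => by
      rw [norm_smul]
      simp only [norm_pow, norm_neg, Complex.norm_I, one_pow, one_mul]
      refine (norm_mul_le _ _).trans
        (mul_le_mul (hHM s (hmem s hs)) ?_ (norm_nonneg _) hM)
      refine (norm_dysonTerm_le hM hHM n s (hmem s hs)).trans ?_
      have := hmem s hs
      gcongr)
    h0 (by simp [dysonTerm_succ_zero, summable_zero]) ht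
  have e1 : timeOrderedExp H = fun s =>
      1 + ∑' n : ℕ, (-Complex.I) ^ (n + 1) • dysonTerm H (n + 1) s := by
    funext s
    rw [timeOrderedExp, (summable_dyson hH s).tsum_eq_zero_add]
    simp [dysonTerm]
  have e2 : (-Complex.I) • (H t * timeOrderedExp H t) =
      ∑' n : ℕ, (-Complex.I) ^ (n + 1) • (H t * dysonTerm H n t) := by
    rw [timeOrderedExp, ← (summable_dyson hH t).tsum_mul_left,
      ← ((summable_dyson hH t).mul_left _).tsum_const_smul]
    refine tsum_congr fun n => ?_
    rw [mul_smul_comm, smul_smul, pow_succ']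
  rw [e2, e1]
  exact hd.const_add 1

theorem commute_dysonTerm {z : QuasiLocal d} (hH : Continuous H) (hz : ∀ t, Commute z (H t))
    (n : ℕ) : ∀ t, Commute z (dysonTerm H n t) := by
  induction n with
  | zero => intro t; exact Commute.one_right z
  | succ n ih =>
    intro t
    have hi : IntervalIntegrable (fun s => H s * dysonTerm H n s) MeasureTheory.volume 0 t :=
      (hH.mul (continuous_dysonTerm hH n)).intervalIntegrable 0 t
    change z * (∫ s in (0 : ℝ)..t, H s * dysonTerm H n s) =
      (∫ s in (0 : ℝ)..t, H s * dysonTerm H n s) * z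
    have e1 := (ContinuousLinearMap.mul ℝ (QuasiLocal d) z).intervalIntegral_comp_comm hi
    have e2 := ((ContinuousLinearMap.mul ℝ (QuasiLocal d)).flip z).intervalIntegral_comp_comm hi
    simp only [ContinuousLinearMap.mul_apply', ContinuousLinearMap.flip_apply] at e1 e2
    rw [← e1, ← e2]
    congr 1
    funext s
    exact ((hz s).mul_right (ih s)).eq

theorem commute_timeOrderedExp {z : QuasiLocal d} (hH : Continuous H)
    (hz : ∀ t, Commute z (H t)) (t : ℝ) : Commute z (timeOrderedExp H t) := by
  change z * timeOrderedExp H t = timeOrderedExp H t * z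
  rw [timeOrderedExp, ← (summable_dyson hH t).tsum_mul_left,
    ← (summable_dyson hH t).tsum_mul_right]
  refine tsum_congr fun n => ?_
  rw [mul_smul_comm, smul_mul_assoc, (commute_dysonTerm hH hz n t).eq]

theorem isPropagator_timeOrderedExp (hH : Continuous H) : IsPropagator H (timeOrderedExp H) :=
  ⟨timeOrderedExp_zero, hasDerivAt_timeOrderedExp hH⟩

/-- Time-ordered exponentials of commuting Hamiltonians multiply. -/
theorem timeOrderedExp_add {H' : ℝ → QuasiLocal d} (hH : Continuous H) (hH' : Continuous H')
    (hc : ∀ s t, Commute (H' s) (H t)) (t : ℝ) :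
    timeOrderedExp (fun s => H s + H' s) t = timeOrderedExp H t * timeOrderedExp H' t :=
  congrFun ((isPropagator_timeOrderedExp (hH.add hH')).unique (hH.add hH')
    ((isPropagator_timeOrderedExp hH).mul (isPropagator_timeOrderedExp hH')
      fun s => commute_timeOrderedExp hH (hc s) s)) t

end Dyson

/-! ### Pointwise limits of inner automorphisms -/

/-- If conjugation by the unitaries `W n`, and by their adjoints, converges on a dense set, then the
limit of the inner automorphisms `x ↦ (W n)* x W n` is a `*`-automorphism. -/
theorem exists_limit_conj {A : Type*} [CStarAlgebra A] {W : ℕ → A} (hW : ∀ n, W n ∈ unitary A)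
    {D : Set A} (hD : Dense D)
    (h1 : ∀ x ∈ D, ∃ y, Tendsto (fun n => star (W n) * x * W n) atTop (𝓝 y))
    (h2 : ∀ x ∈ D, ∃ y, Tendsto (fun n => W n * x * star (W n)) atTop (𝓝 y)) :
    ∃ α : A ≃⋆ₐ[ℂ] A, ∀ x, Tendsto (fun n => star (W n) * x * W n) atTop (𝓝 (α x)) := by
  have hext : ∀ V : ℕ → A, (∀ n, V n ∈ unitary A) →
      (∀ x ∈ D, ∃ y, Tendsto (fun n => star (V n) * x * V n) atTop (𝓝 y)) →
      ∀ x, ∃ y, Tendsto (fun n => star (V n) * x * V n) atTop (𝓝 y) := by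
    intro V hV h x
    have hnorm : ∀ n y, ‖star (V n) * y * V n‖ = ‖y‖ := fun n y => by
      rw [CStarRing.norm_mul_mem_unitary _ (hV n),
        CStarRing.norm_mem_unitary_mul _ (Unitary.star_mem (hV n))]
    refine cauchySeq_tendsto_of_complete (Metric.cauchySeq_iff'.2 fun ε hε => ?_)
    obtain ⟨y, hyD, hy⟩ := Metric.mem_closure_iff.1 (hD x) (ε / 3) (by positivity)
    obtain ⟨z, hz⟩ := h y hyD
    obtain ⟨N, hN⟩ := Metric.cauchySeq_iff'.1 hz.cauchySeq (ε / 3) (by positivity)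
    refine ⟨N, fun n hn => ?_⟩
    have e : ∀ n, dist (star (V n) * x * V n) (star (V n) * y * V n) < ε / 3 := fun n => by
      rw [dist_eq_norm, ← sub_mul, ← mul_sub, hnorm, ← dist_eq_norm]
      exact hy
    calc dist (star (V n) * x * V n) (star (V N) * x * V N)
        ≤ dist (star (V n) * x * V n) (star (V n) * y * V n)
          + dist (star (V n) * y * V n) (star (V N) * y * V N)
          + dist (star (V N) * y * V N) (star (V N) * x * V N) := dist_triangle4 _ _ _ _
      _ < ε / 3 + ε / 3 + ε / 3 := by
          have := e N
          rw [dist_comm] at this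
          exact add_lt_add (add_lt_add (e n) (hN n hn)) this
      _ = ε := by ring
  -- Conjugation is isometric, so that convergence extends from `D`; the limits of the two
  -- conjugations are inverse to each other.
  choose a ha using hext W hW h1
  choose b hb using hext (fun n => star (W n)) (fun n => Unitary.star_mem (hW n))
    (by simpa using h2)
  simp only [star_star] at hb
  have hWs : ∀ n, star (W n) * W n = 1 := fun n => (hW n).1
  have hsW : ∀ n, W n * star (W n) = 1 := fun n => (hW n).2
  have hinv : ∀ (V : ℕ → A), (∀ n, V n ∈ unitary A) → ∀ (x y : A),
      Tendsto (fun n => V n * x * star (V n)) atTop (𝓝 y) →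
      Tendsto (fun n => star (V n) * y * V n) atTop (𝓝 x) := by
    intro V hV x y h
    rw [tendsto_iff_norm_sub_tendsto_zero] at h ⊢
    refine h.congr fun n => ?_
    have e : star (V n) * y * V n - x = star (V n) * (y - V n * x * star (V n)) * V n := by
      have h1 : star (V n) * V n = 1 := (hV n).1
      rw [mul_sub, sub_mul]
      congr 1
      calc x = (star (V n) * V n) * x * (star (V n) * V n) := by rw [h1]; simp
        _ = _ := by simp only [mul_assoc]
    rw [e, CStarRing.norm_mul_mem_unitary _ (hV n),
      CStarRing.norm_mem_unitary_mul _ (Unitary.star_mem (hV n)), norm_sub_rev]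
  refine ⟨
    { toFun := a
      invFun := b
      left_inv := fun x => ?_
      right_inv := fun x => ?_
      map_mul' := fun x y => ?_
      map_add' := fun x y => ?_
      map_star' := fun x => ?_
      map_smul' := fun c x => ?_ }, ha⟩
  · refine tendsto_nhds_unique (hb (a x)) ?_
    simpa using hinv (fun n => star (W n)) (fun n => Unitary.star_mem (hW n)) x (a x)
      (by simpa using ha x)
  · exact tendsto_nhds_unique (ha (b x)) (hinv W hW x (b x) (hb x))
  · refine tendsto_nhds_unique (ha (x * y)) (((ha x).mul (ha y)).congr fun n => ?_)
    calc star (W n) * x * W n * (star (W n) * y * W n)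
        = star (W n) * x * (W n * star (W n)) * y * W n := by simp only [mul_assoc]
      _ = star (W n) * (x * y) * W n := by rw [hsW]; simp only [mul_assoc, mul_one]
  · refine tendsto_nhds_unique (ha (x + y)) (((ha x).add (ha y)).congr fun n => ?_)
    simp [mul_add, add_mul]
  · refine tendsto_nhds_unique (ha (star x)) (((ha x).star).congr fun n => ?_)
    simp [star_mul, mul_assoc]
  · refine tendsto_nhds_unique (ha (c • x)) (((ha x).const_smul c).congr fun n => ?_)
    simp

/-! ### Commutators -/

/-- The commutator `(a, b) ↦ a b - b a` as a bilinear map. -/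
def ad {A : Type*} [Ring A] [Algebra ℂ A] : A →ₗ[ℂ] A →ₗ[ℂ] A :=
  LinearMap.mul ℂ A - (LinearMap.mul ℂ A).flip

theorem ad_apply {A : Type*} [Ring A] [Algebra ℂ A] (a b : A) : ad a b = a * b - b * a := rfl

theorem commute_iff_ad_eq {A : Type*} [Ring A] [Algebra ℂ A] {a b : A} :
    Commute a b ↔ ad a b = 0 := by
  rw [ad_apply, sub_eq_zero]
  rfl

theorem ad_mul {A : Type*} [Ring A] [Algebra ℂ A] (a b c : A) :
    ad a (b * c) = ad a b * c + b * ad a c := by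
  simp only [ad_apply, sub_mul, mul_sub, mul_assoc]
  abel

/-! ### One-site operators and density of local elements -/

section Chain

variable {d : ℕ}

theorem commute_site {k l : ℤ} (hkl : k ≠ l) (x y : Matrix (Fin d) (Fin d) ℂ) :
    Commute (site d k x) (site d l y) := by
  apply toOp_injective d
  rw [map_mul, map_mul]
  change siteOp k x * siteOp l y = siteOp l y * siteOp k x
  ext ψ σ
  simp only [siteOp_apply, mul_apply_eq_comp, Finset.mul_sum]
  rw [Finset.sum_comm]
  refine Finset.sum_congr rfl fun i _ => Finset.sum_congr rfl fun j _ => ?_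
  rw [Function.update_of_ne hkl.symm, Function.update_of_ne hkl, Function.update_comm hkl]
  ring

/-- A bound on the norm of `x⁽ᵏ⁾` that does not depend on the site. -/
def siteBound (x : Matrix (Fin d) (Fin d) ℂ) : ℝ := Real.sqrt ((∑ i, ∑ j, ‖x i j‖ ^ 2) * d)

theorem siteBound_nonneg (x : Matrix (Fin d) (Fin d) ℂ) : 0 ≤ siteBound x := Real.sqrt_nonneg _

theorem norm_siteOp_apply_le (k : ℤ) (x : Matrix (Fin d) (Fin d) ℂ) (ψ : ConfigSpace d) :
    ‖siteOp k x ψ‖ ≤ siteBound x * ‖ψ‖ := by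
  refine abs_le_of_sq_le_sq' ?_ (mul_nonneg (siteBound_nonneg x) (norm_nonneg ψ)) |>.2
  rw [norm_sq_eq, mul_pow, siteBound, Real.sq_sqrt (by positivity), mul_assoc, ← tsum_update k ψ,
    ← tsum_mul_left]
  exact (summable_siteFun k x ψ).tsum_le_tsum (fun σ => siteFun_sq_le k x ψ σ)
    ((summable_update_sum k ψ).mul_left _)

theorem norm_site_le (k : ℤ) (x : Matrix (Fin d) (Fin d) ℂ) : ‖site d k x‖ ≤ siteBound x := by
  rw [← norm_toOp]
  exact ContinuousLinearMap.opNorm_le_bound (siteOp k x) (siteBound_nonneg x)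
    (norm_siteOp_apply_le k x)

theorem isometry_toOp (d : ℕ) : Isometry (toOp d) :=
  AddMonoidHomClass.isometry_of_norm _ norm_toOp

/-- A closed `*`-subalgebra of the quasi-local algebra that contains the one-site operators is
everything. -/
theorem eq_top_of_site_mem {T : StarSubalgebra ℂ (QuasiLocal d)}
    (hT : IsClosed (T : Set (QuasiLocal d))) (h : ∀ k x, site d k x ∈ T) (a : QuasiLocal d) :
    a ∈ T := by
  have hcl : IsClosed ((T.map (toOp d) : StarSubalgebra ℂ (ConfigSpace d →L[ℂ] ConfigSpace d)) :
      Set (ConfigSpace d →L[ℂ] ConfigSpace d)) := by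
    have : ((T.map (toOp d) : StarSubalgebra ℂ (ConfigSpace d →L[ℂ] ConfigSpace d)) :
      Set (ConfigSpace d →L[ℂ] ConfigSpace d)) = toOp d '' T := rfl
    rw [this]
    exact (((isometry_toOp d).isUniformInducing.isComplete_iff).2 hT.isComplete).isClosed
  have hle : (⨆ I : ℤ × ℤ, localAlgebra d I.1 I.2) ≤ T.map (toOp d) := by
    refine iSup_le fun I => StarAlgebra.adjoin_le ?_
    rintro A ⟨k, -, x, rfl⟩
    exact ⟨site d k x, h k x, rfl⟩
  obtain ⟨b, hb, hba⟩ := StarSubalgebra.topologicalClosure_minimal hle hcl (toOp_mem a)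
  rwa [← toOp_injective d hba]

/-- `O` commutes with all one-site operators at the sites `k ≥ S`. In contrast to support in
`[0, S - 1]`, this leaves the sites `k < 0` free, so that such elements are dense. They are treated
alike, because the dynamics of the sites `0, …, N - 1` acts trivially at `k < 0`. -/
def IsSupportedBelow (O : QuasiLocal d) (S : ℕ) : Prop :=
  ∀ k : ℤ, (S : ℤ) ≤ k → ∀ x, Commute O (site d k x)

theorem IsSupportedBelow.mono {O : QuasiLocal d} {S S' : ℕ} (h : IsSupportedBelow O S)
    (hS : S ≤ S') : IsSupportedBelow O S' :=
  fun k hk => h k (le_trans (by exact_mod_cast hS) hk)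

theorem IsSupportedBelow.mul {O P : QuasiLocal d} {S : ℕ} (h : IsSupportedBelow O S)
    (h' : IsSupportedBelow P S) : IsSupportedBelow (O * P) S :=
  fun k hk x => (h k hk x).mul_left (h' k hk x)

theorem IsSupportedBelow.add {O P : QuasiLocal d} {S : ℕ} (h : IsSupportedBelow O S)
    (h' : IsSupportedBelow P S) : IsSupportedBelow (O + P) S :=
  fun k hk x => (h k hk x).add_left (h' k hk x)

theorem IsSupportedBelow.sub {O P : QuasiLocal d} {S : ℕ} (h : IsSupportedBelow O S)
    (h' : IsSupportedBelow P S) : IsSupportedBelow (O - P) S :=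
  fun k hk x => (h k hk x).sub_left (h' k hk x)

theorem IsSupportedBelow.star {O : QuasiLocal d} {S : ℕ} (h : IsSupportedBelow O S) :
    IsSupportedBelow (star O) S := by
  intro k hk x
  have h1 := (h k hk (Star.star x)).star_star
  rwa [← map_star, _root_.star_star] at h1

theorem isSupportedBelow_site {k : ℤ} {S : ℕ} (hk : k < S) (x : Matrix (Fin d) (Fin d) ℂ) :
    IsSupportedBelow (site d k x) S :=
  fun l hl y => commute_site (by omega) x y

theorem isSupportedBelow_siteSum (S : ℕ) (x : Matrix (Fin d) (Fin d) ℂ) :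
    IsSupportedBelow (siteSum S x) S :=
  fun l hl y => Commute.sum_left _ _ _ fun k hk =>
    isSupportedBelow_site (by exact_mod_cast Finset.mem_range.1 hk) x l hl y

theorem IsSupportedIn.isSupportedBelow {O : QuasiLocal d} {S : ℕ}
    (h : IsSupportedIn O 0 ((S : ℤ) - 1)) : IsSupportedBelow O S :=
  fun k hk x => h k (by simp only [Set.mem_Icc]; omega) x

theorem dense_isSupportedBelow (d : ℕ) :
    Dense {O : QuasiLocal d | ∃ S, IsSupportedBelow O S} := by
  let T : StarSubalgebra ℂ (QuasiLocal d) :=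
    { carrier := {O | ∃ S, IsSupportedBelow O S}
      mul_mem' := by
        rintro a b ⟨S, hS⟩ ⟨S', hS'⟩
        exact ⟨max S S', (hS.mono (le_max_left _ _)).mul (hS'.mono (le_max_right _ _))⟩
      add_mem' := by
        rintro a b ⟨S, hS⟩ ⟨S', hS'⟩
        exact ⟨max S S', (hS.mono (le_max_left _ _)).add (hS'.mono (le_max_right _ _))⟩
      algebraMap_mem' := fun c => ⟨0, fun k _ x => Algebra.commute_algebraMap_left c _⟩
      star_mem' := by
        rintro a ⟨S, hS⟩
        exact ⟨S, hS.star⟩ }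
  intro a
  exact eq_top_of_site_mem (T := T.topologicalClosure) T.isClosed_topologicalClosure
    (fun k x => T.le_topologicalClosure ⟨(k + 1).toNat, isSupportedBelow_site (by omega) x⟩) a

/-! ### Sums of one-site operators and mean-field operators -/

theorem siteSum_smul (N : ℕ) (c : ℂ) (x : Matrix (Fin d) (Fin d) ℂ) :
    siteSum N (c • x) = c • siteSum N x := by
  simp [siteSum, Finset.smul_sum]

theorem siteSum_sum {ι : Type*} (s : Finset ι) (N : ℕ) (x : ι → Matrix (Fin d) (Fin d) ℂ) :
    siteSum N (∑ i ∈ s, x i) = ∑ i ∈ s, siteSum N (x i) := by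
  simp only [siteSum, map_sum]
  exact Finset.sum_comm

theorem star_siteSum (N : ℕ) (x : Matrix (Fin d) (Fin d) ℂ) :
    star (siteSum N x) = siteSum N (star x) := by
  simp [siteSum, map_star]

theorem siteSum_ad_site (N : ℕ) (x y : Matrix (Fin d) (Fin d) ℂ) (k : ℤ) :
    ad (siteSum N x) (site d k y) = if 0 ≤ k ∧ k < N then site d k (ad x y) else 0 := by
  have e : ∀ l : ℕ, ad (site d (l : ℤ) x) (site d k y) =
      if (l : ℤ) = k then site d k (ad x y) else 0 := by
    intro l
    split_ifs with h
    · rw [h, ad_apply, ad_apply, map_sub, map_mul, map_mul]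
    · exact (commute_iff_ad_eq).1 (commute_site h x y)
  rw [siteSum, map_sum, LinearMap.sum_apply, Finset.sum_congr rfl fun l _ => e l]
  split_ifs with h
  · obtain ⟨n, rfl⟩ := Int.eq_ofNat_of_zero_le h.1
    rw [Finset.sum_eq_single n]
    · simp
    · intro l _ hl
      rw [if_neg (by exact_mod_cast hl)]
    · intro hn
      exact absurd (Finset.mem_range.2 (by exact_mod_cast h.2)) hn
  · refine Finset.sum_eq_zero fun l hl => if_neg fun hlk => h ?_
    have := Finset.mem_range.1 hl
    omega

theorem siteSum_ad_siteSum (N : ℕ) (x y : Matrix (Fin d) (Fin d) ℂ) :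
    ad (siteSum N x) (siteSum N y) = siteSum N (ad x y) := by
  conv_lhs => rw [siteSum.eq_def N y, map_sum]
  rw [siteSum.eq_def N (ad x y)]
  refine Finset.sum_congr rfl fun k hk => ?_
  rw [siteSum_ad_site, if_pos]
  exact ⟨by positivity, by exact_mod_cast Finset.mem_range.1 hk⟩

theorem siteSum_ad_of_isSupportedBelow {O : QuasiLocal d} {S N : ℕ} (h : IsSupportedBelow O S)
    (hN : S ≤ N) (x : Matrix (Fin d) (Fin d) ℂ) : ad (siteSum N x) O = ad (siteSum S x) O := by
  rw [siteSum, siteSum, ← Finset.sum_range_add_sum_Ico _ hN, map_add, LinearMap.add_apply,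
    add_eq_left, map_sum, LinearMap.sum_apply]
  refine Finset.sum_eq_zero fun k hk => commute_iff_ad_eq.1 (h k ?_ x).symm
  exact_mod_cast (Finset.mem_Ico.1 hk).1

theorem norm_siteSum_le (N : ℕ) (x : Matrix (Fin d) (Fin d) ℂ) :
    ‖siteSum N x‖ ≤ N * siteBound x := by
  refine (norm_sum_le _ _).trans
    ((Finset.sum_le_sum fun (k : ℕ) _ => norm_site_le (k : ℤ) x).trans ?_)
  simp

theorem norm_meanField_le (N : ℕ) (x : Matrix (Fin d) (Fin d) ℂ) :
    ‖meanField N x‖ ≤ siteBound x := by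
  rcases Nat.eq_zero_or_pos N with rfl | hN
  · simpa [meanField] using siteBound_nonneg x
  · have hN' : (0 : ℝ) < N := by exact_mod_cast hN
    rw [meanField, norm_smul]
    simp only [norm_div, norm_one, Complex.norm_natCast]
    rw [div_mul_eq_mul_div, one_mul, div_le_iff₀ hN', mul_comm (siteBound x)]
    exact norm_siteSum_le N x

theorem star_meanField (N : ℕ) (x : Matrix (Fin d) (Fin d) ℂ) :
    star (meanField N x) = meanField N (star x) := by
  simp [meanField, star_smul, star_siteSum]

theorem norm_ad_le (a b : QuasiLocal d) : ‖ad a b‖ ≤ 2 * ‖a‖ * ‖b‖ := by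
  rw [ad_apply]
  refine (norm_sub_le _ _).trans ?_
  linarith [norm_mul_le a b, norm_mul_le b a, mul_comm ‖a‖ ‖b‖]

theorem norm_meanField_ad_site_le (N : ℕ) (x y : Matrix (Fin d) (Fin d) ℂ) (k : ℤ) :
    ‖ad (meanField N x) (site d k y)‖ ≤ 1 / N * siteBound (ad x y) := by
  rw [meanField, map_smul, LinearMap.smul_apply, siteSum_ad_site, norm_smul]
  simp only [norm_div, norm_one, Complex.norm_natCast]
  refine mul_le_mul_of_nonneg_left ?_ (by positivity)
  split_ifs
  · exact norm_site_le _ _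
  · simpa using siteBound_nonneg _

/-- Mean-field operators asymptotically commute with every quasi-local element. -/
theorem tendsto_meanField_ad (c : QuasiLocal d) (x : Matrix (Fin d) (Fin d) ℂ) :
    Tendsto (fun N : ℕ => ad (meanField N x) c) atTop (𝓝 0) := by
  let T : StarSubalgebra ℂ (QuasiLocal d) :=
    { carrier := {c | ∀ x : Matrix (Fin d) (Fin d) ℂ,
        Tendsto (fun N : ℕ => ad (meanField N x) c) atTop (𝓝 0)}
      mul_mem' := by
        intro a b ha hb x
        have h := ((ha x).mul_const b).add ((hb x).const_mul a)
        simp only [zero_mul, mul_zero, add_zero] at h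
        refine h.congr fun N => ?_
        simp only [ad_apply, sub_mul, mul_sub, mul_assoc]
        abel
      add_mem' := by
        intro a b ha hb x
        simpa [map_add] using (ha x).add (hb x)
      algebraMap_mem' := by
        intro c x
        have h : ∀ N : ℕ, ad (meanField N x) (algebraMap ℂ (QuasiLocal d) c) = 0 := fun N =>
          commute_iff_ad_eq.1 (Algebra.commute_algebraMap_right c _)
        simp [h]
      star_mem' := by
        intro a ha x
        have h := (ha (star x)).star.neg
        simp only [star_zero, neg_zero] at h
        refine h.congr fun N => ?_
        simp [ad_apply, star_meanField] }
  have hcl : IsClosed (T : Set (QuasiLocal d)) := by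
    refine isClosed_of_closure_subset fun a ha x => ?_
    rw [Metric.tendsto_atTop]
    intro ε hε
    have hB := siteBound_nonneg x
    obtain ⟨b, hb, hab⟩ := Metric.mem_closure_iff.1 ha (ε / (2 * (2 * siteBound x + 1)))
      (by positivity)
    obtain ⟨N₀, hN₀⟩ := Metric.tendsto_atTop.1 (hb x) (ε / 2) (by positivity)
    refine ⟨N₀, fun N hN => ?_⟩
    have h1 := hN₀ N hN
    rw [dist_zero_right] at h1 ⊢
    have h2 : ‖ad (meanField N x) (a - b)‖ ≤ ε / 2 := by
      refine (norm_ad_le _ _).trans ?_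
      rw [dist_eq_norm] at hab
      have h3 : ‖a - b‖ * (2 * (2 * siteBound x + 1)) ≤ ε :=
        ((lt_div_iff₀ (by positivity)).1 hab).le
      nlinarith [norm_meanField_le N x, norm_nonneg (a - b)]
    have h4 : ad (meanField N x) a = ad (meanField N x) (a - b) + ad (meanField N x) b := by
      rw [← map_add, sub_add_cancel]
    rw [h4]
    linarith [norm_add_le (ad (meanField N x) (a - b)) (ad (meanField N x) b)]
  refine eq_top_of_site_mem hcl (fun k y x => ?_) c x
  refine squeeze_zero_norm (fun N => norm_meanField_ad_site_le N x y k) ?_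
  simpa using (tendsto_const_div_atTop_nhds_zero_nat 1).mul_const (siteBound (ad x y))

/-! ### Fluctuations in clustering states -/

instance (d : ℕ) : PartialOrder (QuasiLocal d) := CStarAlgebra.spectralOrder _

instance (d : ℕ) : StarOrderedRing (QuasiLocal d) := CStarAlgebra.spectralOrderedRing _

/-- A state as a positive linear functional for the order of the `C*`-algebra. -/
def IsState.toPositive {ω : QuasiLocal d →ₗ[ℂ] ℂ} (hω : IsState ω) : QuasiLocal d →ₚ[ℂ] ℂ :=
  PositiveLinearMap.mk₀ ω fun x hx => by
    obtain ⟨y, rfl⟩ := CStarAlgebra.nonneg_iff_eq_star_mul_self.1 hx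
    exact hω.nonneg y

theorem IsState.toPositive_apply {ω : QuasiLocal d →ₗ[ℂ] ℂ} (hω : IsState ω) (x : QuasiLocal d) :
    hω.toPositive x = ω x := rfl

theorem gnsNorm_one {ω : QuasiLocal d →ₗ[ℂ] ℂ} (hω : IsState ω) : gnsNorm hω.toPositive 1 = 1 := by
  have h := gnsNorm_one_sq hω.toPositive
  rw [hω.toPositive_apply, hω.map_one, Complex.one_re] at h
  nlinarith [gnsNorm_nonneg hω.toPositive 1]

theorem apply_site_mul_site {ω : QuasiLocal d →ₗ[ℂ] ℂ} (hτ : IsTranslationInvariant ω)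
    (x y : Matrix (Fin d) (Fin d) ℂ) (k : ℕ) (l : ℤ) :
    ω (site d k x * site d (l + k) y) = ω (site d 0 x * site d l y) := by
  induction k with
  | zero => simp
  | succ k ih =>
    rw [← ih, ← hτ (_ * site d (l + k) y), map_mul (translation d), translation_site,
      translation_site]
    push_cast
    rw [add_assoc]

theorem apply_site {ω : QuasiLocal d →ₗ[ℂ] ℂ} (hτ : IsTranslationInvariant ω)
    (x : Matrix (Fin d) (Fin d) ℂ) (k : ℕ) : ω (site d k x) = ω (site d 0 x) := by
  simpa using apply_site_mul_site hτ x 1 k 0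

theorem apply_meanField {ω : QuasiLocal d →ₗ[ℂ] ℂ} (hτ : IsTranslationInvariant ω)
    (x : Matrix (Fin d) (Fin d) ℂ) {N : ℕ} (hN : 0 < N) :
    ω (meanField N x) = ω (site d 0 x) := by
  have hN' : (N : ℂ) ≠ 0 := by exact_mod_cast hN.ne'
  simp [meanField, siteSum, map_sum, apply_site hτ, hN']

theorem apply_siteSum_mul_siteSum {ω : QuasiLocal d →ₗ[ℂ] ℂ} (hτ : IsTranslationInvariant ω)
    (x y : Matrix (Fin d) (Fin d) ℂ) (N : ℕ) :
    ω (siteSum N x * siteSum N y) =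
      ∑ k ∈ Finset.range N, ∑ l ∈ Finset.range N, ω (site d 0 x * site d ((l : ℤ) - k) y) := by
  simp only [siteSum, Finset.sum_mul_sum, map_sum]
  refine Finset.sum_congr rfl fun k _ => Finset.sum_congr rfl fun l _ => ?_
  rw [← apply_site_mul_site hτ x y k, sub_add_cancel]

/-- In a clustering state, covariances of mean-field operators are of order `1/N`. -/
theorem norm_covariance_le {ω : QuasiLocal d →ₗ[ℂ] ℂ} (hτ : IsTranslationInvariant ω)
    (hcl : IsL1Clustering ω) (x y : Matrix (Fin d) (Fin d) ℂ) {N : ℕ} (hN : 0 < N) :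
    ‖ω (meanField N x * meanField N y) - ω (site d 0 x) * ω (site d 0 y)‖ ≤
      1 / N * ∑' l : ℤ, ‖ω (site d 0 x * site d l y) - ω (site d 0 x) * ω (site d 0 y)‖ := by
  set g : ℤ → ℂ := fun l => ω (site d 0 x * site d l y) - ω (site d 0 x) * ω (site d 0 y) with hg
  have hN' : (N : ℂ) ≠ 0 := by exact_mod_cast hN.ne'
  have hNr : (0 : ℝ) < N := by exact_mod_cast hN
  have e : ω (meanField N x * meanField N y) - ω (site d 0 x) * ω (site d 0 y) =
      (1 / (N : ℂ)) ^ 2 * ∑ k ∈ Finset.range N, ∑ l ∈ Finset.range N, g ((l : ℤ) - k) := by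
    simp only [hg, Finset.sum_sub_distrib, ← apply_siteSum_mul_siteSum hτ, meanField,
      smul_mul_smul_comm, map_smul, smul_eq_mul, Finset.sum_const, Finset.card_range, nsmul_eq_mul]
    field_simp
  have hrow : ∀ k ∈ Finset.range N, ‖∑ l ∈ Finset.range N, g ((l : ℤ) - k)‖ ≤ ∑' l, ‖g l‖ := by
    intro k _
    refine (norm_sum_le _ _).trans ?_
    have hinj : Function.Injective fun l : ℕ => (l : ℤ) - k := fun a b hab => by simpa using hab
    calc ∑ l ∈ Finset.range N, ‖g ((l : ℤ) - k)‖
        ≤ ∑' l : ℕ, ‖g ((l : ℤ) - k)‖ :=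
          ((hcl x y).comp_injective hinj).sum_le_tsum _ fun _ _ => norm_nonneg _
      _ ≤ _ := tsum_comp_le_tsum_of_inj (hcl x y) (fun _ => norm_nonneg _) hinj
  rw [e, norm_mul]
  calc ‖(1 / (N : ℂ)) ^ 2‖ * ‖∑ k ∈ Finset.range N, ∑ l ∈ Finset.range N, g ((l : ℤ) - k)‖
      ≤ (1 / N) ^ 2 * (N * ∑' l, ‖g l‖) := by
        have h1 : ‖(1 / (N : ℂ)) ^ 2‖ = (1 / (N : ℝ)) ^ 2 := by simp
        rw [h1]
        refine mul_le_mul_of_nonneg_left ?_ (by positivity)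
        refine (norm_sum_le _ _).trans ((Finset.sum_le_sum hrow).trans ?_)
        simp
    _ = 1 / N * ∑' l, ‖g l‖ := by field_simp

/-- Mean-field operators have vanishing fluctuations in the vector states `x ↦ ω(c* x c)`. -/
theorem tendsto_gnsNorm_meanField_sub {ω : QuasiLocal d →ₗ[ℂ] ℂ} (hω : IsState ω)
    (hτ : IsTranslationInvariant ω) (hcl : IsL1Clustering ω) {x : Matrix (Fin d) (Fin d) ℂ}
    (hx : x.IsHermitian) (c : QuasiLocal d) :
    Tendsto (fun N : ℕ => gnsNorm (functionalConj hω.toPositive c)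
      (meanField N x - ω (site d 0 x) • (1 : QuasiLocal d))) atTop (𝓝 0) := by
  set φ := hω.toPositive with hφ
  set m := ω (site d 0 x) with hm
  have hmreal : star m = m := by
    have h1 := map_star φ (site d 0 x)
    rw [← map_star, show star x = x from hx] at h1
    exact h1.symm
  have hconj : ∀ y, gnsNorm (functionalConj φ c) y = gnsNorm φ (y * c) := by
    intro y
    refine (sq_eq_sq₀ (gnsNorm_nonneg _ _) (gnsNorm_nonneg _ _)).1 ?_
    rw [gnsNorm_sq_re, gnsNorm_sq_re, functionalConj_apply]
    simp [star_mul, mul_assoc]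
  have hsq : Tendsto (fun N : ℕ => gnsNorm φ (meanField N x - m • (1 : QuasiLocal d)) ^ 2) atTop
      (𝓝 0) := by
    have hlim : Tendsto (fun N : ℕ =>
        1 / (N : ℝ) * ∑' l : ℤ, ‖ω (site d 0 x * site d l x) - m * m‖) atTop (𝓝 0) := by
      simpa using (tendsto_const_div_atTop_nhds_zero_nat 1).mul_const
        (∑' l : ℤ, ‖ω (site d 0 x * site d l x) - m * m‖)
    refine squeeze_zero' (Eventually.of_forall fun _ => sq_nonneg _) ?_ hlim
    filter_upwards [eventually_gt_atTop 0] with N hN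
    have e : φ (star (meanField N x - m • (1 : QuasiLocal d)) *
          (meanField N x - m • (1 : QuasiLocal d)))
        = ω (meanField N x * meanField N x) - m * m := by
      rw [star_sub, star_meanField, show star x = x from hx, star_smul, star_one, hmreal,
        hω.toPositive_apply]
      simp only [sub_mul, mul_sub, map_sub, smul_mul_assoc, mul_smul_comm, one_mul, mul_one,
        map_smul, smul_eq_mul, hω.map_one, apply_meanField hτ x hN, ← hm]
      ring
    rw [gnsNorm_sq_re, e]
    exact (Complex.re_le_norm _).trans (norm_covariance_le hτ hcl x x hN)
  have h0 : Tendsto (fun N : ℕ => gnsNorm φ (meanField N x - m • (1 : QuasiLocal d))) atTop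
      (𝓝 0) := by
    have := hsq.sqrt
    simpa [Real.sqrt_sq (gnsNorm_nonneg _ _)] using this
  have h1 : Tendsto (fun N : ℕ => ‖c‖ * gnsNorm φ (meanField N x - m • (1 : QuasiLocal d))
      + ‖ad (meanField N x) c‖) atTop (𝓝 0) := by
    simpa using (h0.const_mul ‖c‖).add (tendsto_meanField_ad c x).norm
  refine squeeze_zero (fun N => gnsNorm_nonneg _ _) (fun N => ?_) h1
  rw [hconj]
  have e : (meanField N x - m • (1 : QuasiLocal d)) * c =
      c * (meanField N x - m • (1 : QuasiLocal d)) + ad (meanField N x) c := by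
    rw [ad_apply, sub_mul, mul_sub, smul_mul_assoc, mul_smul_comm, one_mul, mul_one]
    abel
  rw [e]
  refine (gnsNorm_add_le _ _ _).trans (add_le_add (gnsNorm_mul_le _ _ _) ?_)
  refine (gnsNorm_le _ _).trans ?_
  rw [gnsNorm_one hω, mul_one]

end Chain

/-! ### Orthonormal Hermitian bases -/

section Basis

variable {d : ℕ} {v : Fin (d ^ 2) → Matrix (Fin d) (Fin d) ℂ}

theorem IsHermitianONB.linearIndependent (hv : IsHermitianONB v) : LinearIndependent ℂ v := by
  rw [Fintype.linearIndependent_iff]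
  intro g hg μ
  have h := congrArg (fun x => (x * v μ).trace) hg
  simpa [Finset.sum_mul, Matrix.trace_sum, Matrix.trace_smul, hv.trace_mul] using h

/-- Expansion of a matrix in an orthonormal Hermitian basis. -/
theorem IsHermitianONB.sum_trace_smul (hv : IsHermitianONB v) (x : Matrix (Fin d) (Fin d) ℂ) :
    ∑ κ, (x * v κ).trace • v κ = x := by
  have hcard : Fintype.card (Fin (d ^ 2)) = Module.finrank ℂ (Matrix (Fin d) (Fin d) ℂ) := by
    rw [Module.finrank_matrix]
    simp [sq]
  have hspan := hv.linearIndependent.span_eq_top_of_card_eq_finrank' hcard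
  have hx : x ∈ Submodule.span ℂ (Set.range v) := by rw [hspan]; trivial
  obtain ⟨g, rfl⟩ := (Submodule.mem_span_range_iff_exists_fun ℂ).1 hx
  simp [Finset.sum_mul, Matrix.trace_sum, Matrix.trace_smul, hv.trace_mul]

/-- The structure constants `f_{μνκ} = Tr([v_μ, v_ν] v_κ)` of the basis. -/
def structureConst (v : Fin (d ^ 2) → Matrix (Fin d) (Fin d) ℂ) (μ ν κ : Fin (d ^ 2)) : ℂ :=
  (ad (v μ) (v ν) * v κ).trace

theorem IsHermitianONB.ad_eq (hv : IsHermitianONB v) (μ ν : Fin (d ^ 2)) :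
    ad (v μ) (v ν) = ∑ κ, structureConst v μ ν κ • v κ :=
  (hv.sum_trace_smul _).symm

theorem structureConst_swap (μ ν κ : Fin (d ^ 2)) :
    structureConst v μ κ ν = -structureConst v μ ν κ := by
  simp only [structureConst, ad_apply, sub_mul, Matrix.trace_sub]
  rw [Matrix.trace_mul_cycle (v μ) (v κ) (v ν), Matrix.trace_mul_cycle (v μ) (v ν) (v κ)]
  ring

theorem IsHermitianONB.star_structureConst (hv : IsHermitianONB v) (μ ν κ : Fin (d ^ 2)) :
    star (structureConst v μ ν κ) = -structureConst v μ ν κ := by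
  rw [structureConst, ← Matrix.trace_conjTranspose, ad_apply, Matrix.conjTranspose_mul,
    Matrix.conjTranspose_sub, Matrix.conjTranspose_mul, Matrix.conjTranspose_mul,
    (hv.isHermitian μ).eq, (hv.isHermitian ν).eq, (hv.isHermitian κ).eq, Matrix.trace_mul_comm,
    ← Matrix.trace_neg, ← neg_mul, neg_sub]

end Basis

/-! ### The Lindblad generator -/

section Generator

variable {d : ℕ} {v : Fin (d ^ 2) → Matrix (Fin d) (Fin d) ℂ} {ε : Fin (d ^ 2) → ℝ}
  {h C : Matrix (Fin (d ^ 2)) (Fin (d ^ 2)) ℂ}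

/-- The coefficients `c_μ(m) = ∑_ν B̃_{μν} m_ν + i ε_μ` of the one-site Hamiltonian in the mean
field `m`. -/
def driftCoeff (ε : Fin (d ^ 2) → ℝ) (h C : Matrix (Fin (d ^ 2)) (Fin (d ^ 2)) ℂ)
    (m : Fin (d ^ 2) → ℝ) (μ : Fin (d ^ 2)) : ℂ :=
  (∑ ν, couplingB h C μ ν * (m ν : ℂ)) + Complex.I * (ε μ : ℂ)

/-- The fluctuation `(1/N) ∑_k v_ν⁽ᵏ⁾ - m_ν` of a mean-field operator around `m_ν`. -/
def fluctuation (v : Fin (d ^ 2) → Matrix (Fin d) (Fin d) ℂ) (N : ℕ) (m : Fin (d ^ 2) → ℝ)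
    (ν : Fin (d ^ 2)) : QuasiLocal d :=
  meanField N (v ν) - (m ν : ℂ) • (1 : QuasiLocal d)

/-- The coefficients `i h_{νμ} - C_{νμ}/2` of the double commutators, which arise from ordering the
mean-field operators to the right and carry a factor `1/N`. -/
def orderingCoeff (h C : Matrix (Fin (d ^ 2)) (Fin (d ^ 2)) ℂ) (μ ν : Fin (d ^ 2)) : ℂ :=
  Complex.I * h ν μ - C ν μ / 2

theorem couplingB_eq (hh : h.IsHermitian) (μ ν : Fin (d ^ 2)) :
    couplingB h C μ ν = (Complex.I * h μ ν + C μ ν / 2) + orderingCoeff h C μ ν := by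
  have e : h μ ν + h ν μ = 2 * ((h μ ν).re : ℂ) := by
    rw [← hh.apply ν μ, RCLike.star_def, Complex.add_conj]
    push_cast
    ring
  rw [couplingB, orderingCoeff]
  linear_combination (-Complex.I) * e

/-- The generator, with the mean-field operators ordered to the right and centred at an arbitrary
`m`: commutators with the mean-field Hamiltonian, a part that is linear in the fluctuations, and
double commutators with a factor `1/N`. -/
theorem generator_eq (hh : h.IsHermitian) (m : Fin (d ^ 2) → ℝ) {N : ℕ} (hN : 0 < N)
    (x : QuasiLocal d) :
    generator v ε h C N x =
      ∑ μ, driftCoeff ε h C m μ • ad (siteSum N (v μ)) x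
      + ∑ μ, ∑ ν, couplingB h C μ ν • (ad (siteSum N (v μ)) x * fluctuation v N m ν)
      + (1 / (N : ℂ)) • ∑ μ, ∑ ν, orderingCoeff h C μ ν •
          ad (siteSum N (v ν)) (ad (siteSum N (v μ)) x) := by
  have hN' : (N : ℂ) ≠ 0 := by exact_mod_cast hN.ne'
  set D : Fin (d ^ 2) → QuasiLocal d := fun μ => ad (siteSum N (v μ)) x with hD
  have hsqrt : ((1 / Real.sqrt N : ℝ) : ℂ) * ((1 / Real.sqrt N : ℝ) : ℂ) = 1 / N := by
    rw [← Complex.ofReal_mul, div_mul_div_comm, one_mul, Real.mul_self_sqrt (Nat.cast_nonneg N)]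
    push_cast
    rfl
  have e1 : Complex.I • ⁅freeHamiltonian v ε N + meanFieldHamiltonian v h N, x⁆ =
      ∑ μ, (Complex.I * (ε μ : ℂ)) • D μ
      + ∑ μ, ∑ ν, (Complex.I * h μ ν * (1 / (N : ℂ))) •
          (D μ * siteSum N (v ν) + siteSum N (v μ) * D ν) := by
    have : ⁅freeHamiltonian v ε N + meanFieldHamiltonian v h N, x⁆ =
        ad (freeHamiltonian v ε N + meanFieldHamiltonian v h N) x := rfl
    rw [this, map_add, LinearMap.add_apply, smul_add, freeHamiltonian, meanFieldHamiltonian]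
    simp only [map_sum, LinearMap.sum_apply, map_smul, LinearMap.smul_apply, Finset.smul_sum,
      smul_smul]
    congr 1
    refine Finset.sum_congr rfl fun μ _ => Finset.sum_congr rfl fun ν _ => ?_
    rw [mul_assoc]
    congr 1
    simp only [hD, ad_apply, sub_mul, mul_sub, mul_assoc]
    abel
  have e2 : ∑ μ, ∑ ν, (C μ ν / 2) •
        (⁅collective N (v μ), x⁆ * collective N (v ν)
          + collective N (v μ) * ⁅x, collective N (v ν)⁆) =
      ∑ μ, ∑ ν, (C μ ν / 2 * (1 / (N : ℂ))) •
        (D μ * siteSum N (v ν) - siteSum N (v μ) * D ν) := by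
    refine Finset.sum_congr rfl fun μ _ => Finset.sum_congr rfl fun ν _ => ?_
    rw [mul_smul, ← hsqrt]
    congr 1
    simp only [hD, ad_apply, Ring.lie_def, collective, smul_mul_assoc, mul_smul_comm, ← smul_sub,
      smul_smul, ← smul_add, mul_sub, sub_mul, mul_assoc]
    congr 1
    abel
  have hsplit : ∑ μ, ∑ ν, (Complex.I * h μ ν * (1 / (N : ℂ))) •
          (D μ * siteSum N (v ν) + siteSum N (v μ) * D ν)
      + ∑ μ, ∑ ν, (C μ ν / 2 * (1 / (N : ℂ))) •
        (D μ * siteSum N (v ν) - siteSum N (v μ) * D ν) =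
      ∑ μ, ∑ ν, ((1 / (N : ℂ)) * (Complex.I * h μ ν + C μ ν / 2)) • (D μ * siteSum N (v ν))
      + ∑ μ, ∑ ν, ((1 / (N : ℂ)) * orderingCoeff h C μ ν) • (siteSum N (v ν) * D μ) := by
    rw [Finset.sum_comm (f := fun μ ν => ((1 / (N : ℂ)) * orderingCoeff h C μ ν) •
      (siteSum N (v ν) * D μ))]
    simp only [← Finset.sum_add_distrib]
    refine Finset.sum_congr rfl fun μ _ => Finset.sum_congr rfl fun ν _ => ?_
    rw [orderingCoeff]
    module
  have hfl : ∀ μ ν, couplingB h C μ ν • (D μ * fluctuation v N m ν) =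
      (couplingB h C μ ν * (1 / (N : ℂ))) • (D μ * siteSum N (v ν))
        - (couplingB h C μ ν * (m ν : ℂ)) • D μ := by
    intro μ ν
    rw [fluctuation, meanField, mul_sub, mul_smul_comm, mul_smul_comm, mul_one, smul_sub,
      smul_smul, smul_smul]
  have had : ∀ μ ν, ad (siteSum N (v ν)) (D μ) = siteSum N (v ν) * D μ - D μ * siteSum N (v ν) :=
    fun μ ν => rfl
  change _ = ∑ μ, driftCoeff ε h C m μ • D μ
      + ∑ μ, ∑ ν, couplingB h C μ ν • (D μ * fluctuation v N m ν)
      + (1 / (N : ℂ)) • ∑ μ, ∑ ν, orderingCoeff h C μ ν • ad (siteSum N (v ν)) (D μ)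
  rw [generator_apply, e1, e2, add_assoc, hsplit]
  simp only [hfl, had]
  simp only [driftCoeff, add_smul, Finset.sum_smul, Finset.sum_add_distrib,
    Finset.sum_sub_distrib, couplingB_eq hh, Finset.smul_sum, smul_sub, smul_smul, mul_add, add_mul]
  simp only [mul_comm (1 / (N : ℂ))]
  abel

/-! ### Positivity and derivative of the dynamics -/

theorem isSelfAdjoint_siteSum (N : ℕ) {x : Matrix (Fin d) (Fin d) ℂ} (hx : x.IsHermitian) :
    IsSelfAdjoint (siteSum N x) := by
  rw [isSelfAdjoint_iff, star_siteSum, show star x = x from hx]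

theorem isSelfAdjoint_fluctuation (hv : IsHermitianONB v) (N : ℕ) (m : Fin (d ^ 2) → ℝ)
    (ν : Fin (d ^ 2)) : IsSelfAdjoint (fluctuation v N m ν) := by
  rw [isSelfAdjoint_iff, fluctuation, star_sub, star_meanField,
    show star (v ν) = v ν from hv.isHermitian ν, star_smul, star_one]
  simp

/-- A quadratic form `∑_{μν} a_{μν} X_μ X_ν` with Hermitian coefficients and self-adjoint `X_μ` is
self-adjoint. -/
theorem isSelfAdjoint_sum_mul {ι A : Type*} [Fintype ι] [CStarAlgebra A] {a : Matrix ι ι ℂ}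
    (ha : a.IsHermitian) {X : ι → A} (hX : ∀ μ, IsSelfAdjoint (X μ)) :
    IsSelfAdjoint (∑ μ, ∑ ν, a μ ν • (X μ * X ν)) := by
  rw [isSelfAdjoint_iff]
  simp only [star_sum, star_smul, star_mul, (hX _).star_eq, ha.apply]
  exact Finset.sum_comm

theorem generator_one (N : ℕ) : generator v ε h C N 1 = 0 := by
  simp [generator_apply, Ring.lie_def]

open scoped MatrixOrder in
theorem exists_eq_conjTranspose_mul_self {n : Type*} [Fintype n] [DecidableEq n]
    {C : Matrix n n ℂ} (hC : C.PosSemidef) : ∃ R : Matrix n n ℂ, C = R.conjTranspose * R :=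
  CStarAlgebra.nonneg_iff_eq_star_mul_self.1 hC.nonneg

/-- The dynamics preserves positivity: with `C = R* R`, the generator has the form
`G* x + x G + Φ x` for the positive map `Φ x = ∑_{μν} C_{μν} V_μ x V_ν`. -/
theorem dynamics_nonneg (hv : IsHermitianONB v) (hh : h.IsHermitian) (hC : C.PosSemidef) (N : ℕ)
    {t : ℝ} (ht : 0 ≤ t) {x : QuasiLocal d} (hx : 0 ≤ x) : 0 ≤ dynamics v ε h C N t x := by
  obtain ⟨R, hCdef⟩ := exists_eq_conjTranspose_mul_self hC
  set V : Fin (d ^ 2) → QuasiLocal d := fun μ => collective N (v μ) with hV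
  have hVs : ∀ μ, star (V μ) = V μ := fun μ => by
    simp [hV, collective, star_smul, (isSelfAdjoint_siteSum N (hv.isHermitian μ)).star_eq]
  set Hm := freeHamiltonian v ε N + meanFieldHamiltonian v h N with hHm
  have hHs : star Hm = Hm := by
    have h1 : IsSelfAdjoint (freeHamiltonian v ε N) := by
      simp [isSelfAdjoint_iff, freeHamiltonian, star_smul,
        (isSelfAdjoint_siteSum N (hv.isHermitian _)).star_eq]
    have h2 : IsSelfAdjoint (meanFieldHamiltonian v h N) :=
      isSelfAdjoint_sum_mul (a := fun μ ν => h μ ν * (1 / (N : ℂ)))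
        (Matrix.IsHermitian.ext fun μ ν => by simp [← hh.apply μ ν])
        (fun μ => isSelfAdjoint_siteSum N (hv.isHermitian μ))
    exact (h1.add h2).star_eq
  set Q : QuasiLocal d := ∑ μ, ∑ ν, (C μ ν / 2) • (V μ * V ν) with hQ
  have hQs : star Q = Q :=
    (isSelfAdjoint_sum_mul (a := fun μ ν => C μ ν / 2)
      (Matrix.IsHermitian.ext fun μ ν => by simp [← hC.isHermitian.apply μ ν]) hVs).star_eq
  set G : QuasiLocal d := (-Complex.I) • Hm - Q with hG
  set Φ : QuasiLocal d →L[ℂ] QuasiLocal d :=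
    ∑ μ, ∑ ν, C μ ν • (lmul (V μ)).comp (rmul (V ν)) with hΦ
  have hΦx : ∀ y, Φ y = ∑ μ, ∑ ν, C μ ν • (V μ * (y * V ν)) := fun y => by
    simp [hΦ, lmul, rmul]
  have hΦpos : ∀ y, 0 ≤ y → 0 ≤ Φ y := by
    intro y hy
    have e : Φ y = ∑ j, star (∑ μ, R j μ • V μ) * y * (∑ ν, R j ν • V ν) := by
      have ej : ∀ j, star (∑ μ, R j μ • V μ) * y * (∑ ν, R j ν • V ν) =
          ∑ μ, ∑ ν, (star (R j μ) * R j ν) • (V μ * (y * V ν)) := by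
        intro j
        rw [star_sum, Finset.sum_mul, Finset.sum_mul_sum]
        refine Finset.sum_congr rfl fun μ _ => Finset.sum_congr rfl fun ν _ => ?_
        rw [star_smul, hVs, smul_mul_assoc, smul_mul_smul_comm, mul_assoc]
      rw [hΦx]
      symm
      rw [Finset.sum_congr rfl fun j _ => ej j, Finset.sum_comm]
      refine Finset.sum_congr rfl fun μ _ => ?_
      rw [Finset.sum_comm]
      refine Finset.sum_congr rfl fun ν _ => ?_
      rw [← Finset.sum_smul, hCdef, Matrix.mul_apply]
      rfl
    rw [e]
    exact Finset.sum_nonneg fun j _ => star_left_conjugate_nonneg hy _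
  refine exp_lindblad_nonneg (G := G) hΦpos (fun y => ?_) ht hx
  have hGs : star G = Complex.I • Hm - Q := by
    simp [hG, star_smul, hHs, hQs]
  rw [hGs, generator_apply, hΦx, hG, Ring.lie_def]
  have e : ∀ μ ν, (C μ ν / 2) • (⁅collective N (v μ), y⁆ * collective N (v ν)
            + collective N (v μ) * ⁅y, collective N (v ν)⁆) =
      C μ ν • (V μ * (y * V ν)) - ((C μ ν / 2) • (V μ * V ν)) * y
        - y * ((C μ ν / 2) • (V μ * V ν)) := by
    intro μ ν
    simp only [Ring.lie_def, hV, sub_mul, mul_sub, smul_mul_assoc, mul_smul_comm, mul_assoc]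
    module
  simp only [e, Finset.sum_sub_distrib, ← Finset.sum_mul, ← Finset.mul_sum]
  rw [← hQ]
  simp only [sub_mul, mul_sub, smul_mul_assoc, mul_smul_comm, smul_sub]
  module

theorem hasDerivAt_dynamics (N : ℕ) (t : ℝ) :
    HasDerivAt (fun s => dynamics v ε h C N s)
      ((dynamics v ε h C N t).comp (generator v ε h C N)) t := by
  have h1 := hasDerivAt_exp_smul_const (𝕂 := ℂ) (generator v ε h C N) (t : ℂ)
  have h2 := h1.scomp t Complex.ofRealCLM.hasDerivAt
  refine h2.congr_deriv ?_
  rw [Complex.ofRealCLM_apply, Complex.ofReal_one]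
  exact one_smul ℂ (dynamics v ε h C N t * generator v ε h C N)

theorem hasDerivAt_dynamics_apply (N : ℕ) {y : ℝ → QuasiLocal d} {y' : QuasiLocal d} {t : ℝ}
    (hy : HasDerivAt y y' t) :
    HasDerivAt (fun s => dynamics v ε h C N s (y s))
      (dynamics v ε h C N t (generator v ε h C N (y t) + y')) t := by
  have h1 := (ContinuousLinearMap.restrictScalarsL ℂ (QuasiLocal d) (QuasiLocal d) ℝ
    ℝ).hasFDerivAt.comp_hasDerivAt t (hasDerivAt_dynamics (v := v) (ε := ε) (h := h) (C := C) N t)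
  have h2 := h1.clm_apply hy
  rw [map_add]
  exact h2

theorem dynamics_zero (N : ℕ) : dynamics v ε h C N 0 = 1 := by
  rw [dynamics]
  have : ((0 : ℝ) : ℂ) • generator v ε h C N = 0 := by
    ext y
    simp
  rw [this, NormedSpace.exp_zero]

theorem dynamics_one (N : ℕ) (t : ℝ) : dynamics v ε h C N t 1 = 1 := by
  have hd : ∀ s, HasDerivAt (fun s => dynamics v ε h C N s (1 : QuasiLocal d)) 0 s := fun s =>
    (hasDerivAt_dynamics_apply N (hasDerivAt_const s (1 : QuasiLocal d))).congr_deriv (by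
      simp [generator_one])
  have := is_const_of_deriv_eq_zero (fun s => (hd s).differentiableAt) (fun s => (hd s).deriv) t 0
  simpa [dynamics_zero] using this

end Generator

/-! ### The mean-field equations -/

section MeanField

variable {d : ℕ} {v : Fin (d ^ 2) → Matrix (Fin d) (Fin d) ℂ} {ε : Fin (d ^ 2) → ℝ}
  {h C : Matrix (Fin (d ^ 2)) (Fin (d ^ 2)) ℂ}

/-- The velocity `∑_μ c_μ(m) ∑_κ f_{μνκ} m_κ` of the macroscopic averages. -/
def meanFieldVelocity (v : Fin (d ^ 2) → Matrix (Fin d) (Fin d) ℂ) (ε : Fin (d ^ 2) → ℝ)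
    (h C : Matrix (Fin (d ^ 2)) (Fin (d ^ 2)) ℂ) (m : Fin (d ^ 2) → ℝ) (ν : Fin (d ^ 2)) : ℂ :=
  ∑ μ, driftCoeff ε h C m μ * ∑ κ, structureConst v μ ν κ * (m κ : ℂ)

theorem star_couplingB (hC : C.IsHermitian) (μ ν : Fin (d ^ 2)) :
    star (couplingB h C μ ν) = -couplingB h C μ ν := by
  have e1 : (starRingEnd ℂ) (C μ ν) = C ν μ := hC.apply ν μ
  have e2 : (starRingEnd ℂ) (C ν μ) = C μ ν := hC.apply μ ν
  simp only [couplingB, RCLike.star_def, map_add, map_sub, map_div₀, map_mul, e1, e2,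
    Complex.conj_I, Complex.conj_ofReal, Complex.conj_ofNat]
  ring

theorem star_driftCoeff (hC : C.IsHermitian) (m : Fin (d ^ 2) → ℝ) (μ : Fin (d ^ 2)) :
    star (driftCoeff ε h C m μ) = -driftCoeff ε h C m μ := by
  simp only [driftCoeff, star_add, star_sum, star_mul', star_couplingB hC]
  simp only [RCLike.star_def, Complex.conj_ofReal, Complex.conj_I, neg_mul, Finset.sum_neg_distrib]
  ring

theorem meanFieldVelocity_re (hv : IsHermitianONB v) (hC : C.IsHermitian) (m : Fin (d ^ 2) → ℝ)
    (ν : Fin (d ^ 2)) :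
    (((meanFieldVelocity v ε h C m ν).re : ℝ) : ℂ) = meanFieldVelocity v ε h C m ν := by
  refine Complex.conj_eq_iff_re.1 ?_
  change star (meanFieldVelocity v ε h C m ν) = _
  simp only [meanFieldVelocity, star_sum, star_mul', star_driftCoeff hC, hv.star_structureConst]
  simp

/-- The mean-field equations preserve `∑_ν m_ν²`, by antisymmetry of the structure constants. -/
theorem sum_mul_meanFieldVelocity (m : Fin (d ^ 2) → ℝ) :
    ∑ ν, (m ν : ℂ) * meanFieldVelocity v ε h C m ν = 0 := by
  have e : ∀ μ, ∑ ν, ∑ κ, (m ν : ℂ) * (structureConst v μ ν κ * (m κ : ℂ)) = 0 := by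
    intro μ
    refine self_eq_neg.1 ?_
    conv_lhs => rw [Finset.sum_comm]
    simp only [← Finset.sum_neg_distrib]
    refine Finset.sum_congr rfl fun κ _ => Finset.sum_congr rfl fun ν _ => ?_
    rw [structureConst_swap]
    ring
  simp only [meanFieldVelocity, Finset.mul_sum]
  rw [Finset.sum_comm]
  refine Finset.sum_eq_zero fun μ _ => ?_
  have e' := congrArg (fun z => driftCoeff ε h C m μ * z) (e μ)
  simp only [Finset.mul_sum, mul_zero] at e'
  rw [← e']
  refine Finset.sum_congr rfl fun κ _ => Finset.sum_congr rfl fun ν _ => ?_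
  ring

/-- Global bounded solutions of the mean-field equations. -/
theorem exists_meanField_solution (hv : IsHermitianONB v) (hC : C.IsHermitian)
    (ε : Fin (d ^ 2) → ℝ) (h : Matrix (Fin (d ^ 2)) (Fin (d ^ 2)) ℂ) (x₀ : Fin (d ^ 2) → ℝ) :
    ∃ m : Fin (d ^ 2) → ℝ → ℝ, (∀ ν, m ν 0 = x₀ ν) ∧
      (∀ ν t, HasDerivAt (fun s => (m ν s : ℂ))
        (meanFieldVelocity v ε h C (fun κ => m κ t) ν) t) ∧
      ∃ R, ∀ ν t, |m ν t| ≤ R := by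
  let F : EuclideanSpace ℝ (Fin (d ^ 2)) → EuclideanSpace ℝ (Fin (d ^ 2)) := fun x =>
    WithLp.toLp 2 fun ν => (meanFieldVelocity v ε h C (fun κ => x κ) ν).re
  have hcoord : ∀ κ, ContDiff ℝ 1 fun x : EuclideanSpace ℝ (Fin (d ^ 2)) => ((x κ : ℝ) : ℂ) :=
    fun κ => Complex.ofRealCLM.contDiff.comp
      (EuclideanSpace.proj κ : EuclideanSpace ℝ (Fin (d ^ 2)) →L[ℝ] ℝ).contDiff
  have hF : ContDiff ℝ 1 F := by
    refine contDiff_euclidean.2 fun ν => ?_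
    refine Complex.reCLM.contDiff.comp (ContDiff.sum fun μ _ => ContDiff.mul ?_ ?_)
    · exact (ContDiff.sum fun κ _ => contDiff_const.mul (hcoord κ)).add contDiff_const
    · exact ContDiff.sum fun κ _ => contDiff_const.mul (hcoord κ)
  have horth : ∀ x, inner ℝ x (F x) = 0 := by
    intro x
    have e := congrArg Complex.re (sum_mul_meanFieldVelocity (v := v) (ε := ε) (h := h) (C := C)
      (fun κ => x κ))
    rw [PiLp.inner_apply]
    simpa [F, mul_comm] using e
  obtain ⟨m, hm0, hm, hnorm⟩ := exists_integralCurve_of_inner_eq_zero hF horth (WithLp.toLp 2 x₀)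
  refine ⟨fun ν t => m t ν, fun ν => by simp [hm0], fun ν t => ?_, ‖WithLp.toLp 2 x₀‖,
    fun ν t => ?_⟩
  · have h1 := ((EuclideanSpace.proj ν : EuclideanSpace ℝ (Fin (d ^ 2)) →L[ℝ] ℝ).hasFDerivAt
      (x := m t)).comp_hasDerivAt t (hm t)
    have h2 := h1.ofReal_comp
    rw [← meanFieldVelocity_re hv hC]
    exact h2
  · rw [← hnorm t]
    exact PiLp.norm_apply_le (m t) ν

end MeanField

/-! ### Growth of the fluctuations -/

section SumBounds

variable {A : Type*} [CStarAlgebra A] [PartialOrder A] {ι κ : Type*} [Fintype ι] [Fintype κ]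

theorem norm_apply_sum_smul_le (φ : A →ₚ[ℂ] ℂ) (a : ι → ℂ) {x : ι → A} {M : ℝ}
    (hx : ∀ i, ‖φ (x i)‖ ≤ M) : ‖φ (∑ i, a i • x i)‖ ≤ (∑ i, ‖a i‖) * M := by
  rw [map_sum, Finset.sum_mul]
  refine norm_sum_le_of_le _ fun i _ => ?_
  rw [map_smul, norm_smul]
  exact mul_le_mul_of_nonneg_left (hx i) (norm_nonneg _)

theorem norm_apply_sum_sum_smul_le (φ : A →ₚ[ℂ] ℂ) (a : ι → κ → ℂ) {x : ι → κ → A} {M : ℝ}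
    (hx : ∀ i j, ‖φ (x i j)‖ ≤ M) :
    ‖φ (∑ i, ∑ j, a i j • x i j)‖ ≤ (∑ i, ∑ j, ‖a i j‖) * M := by
  rw [map_sum, Finset.sum_mul]
  exact norm_sum_le_of_le _ fun i _ => norm_apply_sum_smul_le φ (a i) (hx i)

theorem norm_sum_smul_le {E : Type*} [SeminormedAddCommGroup E] [NormedSpace ℂ E] (a : ι → ℂ)
    {x : ι → E} {M : ℝ} (hx : ∀ i, ‖x i‖ ≤ M) : ‖∑ i, a i • x i‖ ≤ (∑ i, ‖a i‖) * M := by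
  rw [Finset.sum_mul]
  refine norm_sum_le_of_le _ fun i _ => ?_
  rw [norm_smul]
  exact mul_le_mul_of_nonneg_left (hx i) (norm_nonneg _)

end SumBounds

section Fluctuation

variable {d : ℕ} {v : Fin (d ^ 2) → Matrix (Fin d) (Fin d) ℂ} {ε : Fin (d ^ 2) → ℝ}
  {h C : Matrix (Fin (d ^ 2)) (Fin (d ^ 2)) ℂ}

/-- The commutator of the collective `v_μ` with the mean-field operator of `v_ν`: a bounded
combination of mean-field operators. -/
def rotated (v : Fin (d ^ 2) → Matrix (Fin d) (Fin d) ℂ) (N : ℕ) (μ ν : Fin (d ^ 2)) :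
    QuasiLocal d :=
  ∑ κ, structureConst v μ ν κ • meanField N (v κ)

theorem ad_siteSum_meanField (hv : IsHermitianONB v) (N : ℕ) (μ ν : Fin (d ^ 2)) :
    ad (siteSum N (v μ)) (meanField N (v ν)) = rotated v N μ ν := by
  rw [meanField, map_smul, siteSum_ad_siteSum, hv.ad_eq, siteSum_sum, Finset.smul_sum, rotated]
  refine Finset.sum_congr rfl fun κ _ => ?_
  rw [siteSum_smul, meanField, smul_comm]

theorem ad_one {A : Type*} [Ring A] [Algebra ℂ A] (a : A) : ad a 1 = 0 := by
  rw [ad_apply, mul_one, one_mul, sub_self]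

theorem ad_siteSum_fluctuation (hv : IsHermitianONB v) (N : ℕ) (m : Fin (d ^ 2) → ℝ)
    (μ ν : Fin (d ^ 2)) : ad (siteSum N (v μ)) (fluctuation v N m ν) = rotated v N μ ν := by
  rw [fluctuation, map_sub, map_smul, ad_one, smul_zero, sub_zero, ad_siteSum_meanField hv]

theorem ad_siteSum_rotated (hv : IsHermitianONB v) (N : ℕ) (l μ ν : Fin (d ^ 2)) :
    ad (siteSum N (v l)) (rotated v N μ ν) =
      ∑ κ, structureConst v μ ν κ • rotated v N l κ := by
  rw [rotated, map_sum]
  simp only [map_smul, ad_siteSum_meanField hv]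

theorem ad_rotated_fluctuation (hv : IsHermitianONB v) (N : ℕ) (m : Fin (d ^ 2) → ℝ)
    (μ ν : Fin (d ^ 2)) :
    ad (rotated v N μ ν) (fluctuation v N m ν) =
      (1 / (N : ℂ)) • ∑ κ, structureConst v μ ν κ • rotated v N κ ν := by
  rw [rotated, map_sum, LinearMap.sum_apply, Finset.smul_sum]
  refine Finset.sum_congr rfl fun κ _ => ?_
  rw [map_smul, LinearMap.smul_apply, meanField, map_smul, LinearMap.smul_apply,
    ad_siteSum_fluctuation hv, smul_comm]

theorem rotated_eq (N : ℕ) (m : Fin (d ^ 2) → ℝ) (μ ν : Fin (d ^ 2)) :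
    rotated v N μ ν = ∑ κ, structureConst v μ ν κ • fluctuation v N m κ
      + (∑ κ, structureConst v μ ν κ * (m κ : ℂ)) • (1 : QuasiLocal d) := by
  rw [rotated, Finset.sum_smul, ← Finset.sum_add_distrib]
  refine Finset.sum_congr rfl fun κ _ => ?_
  rw [fluctuation, smul_sub, smul_smul, sub_add_cancel]

/-- The time derivative of the squared fluctuations at a solution of the mean-field equations is
quadratic in the fluctuations, up to terms of order `1/N`: the terms of first order cancel. -/
theorem generator_fluctuation_sq (hv : IsHermitianONB v) (hh : h.IsHermitian)
    (m : Fin (d ^ 2) → ℝ) {N : ℕ} (hN : 0 < N) (ν : Fin (d ^ 2)) :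
    generator v ε h C N (fluctuation v N m ν * fluctuation v N m ν)
        - (2 * meanFieldVelocity v ε h C m ν) • fluctuation v N m ν =
      ∑ μ, ∑ κ, (driftCoeff ε h C m μ * structureConst v μ ν κ) •
        (fluctuation v N m κ * fluctuation v N m ν + fluctuation v N m ν * fluctuation v N m κ)
      + ∑ μ, ∑ l, couplingB h C μ l •
        ((rotated v N μ ν * fluctuation v N m ν + fluctuation v N m ν * rotated v N μ ν)
          * fluctuation v N m l)
      + (1 / (N : ℂ)) • ∑ μ, ∑ l, orderingCoeff h C μ l • ad (siteSum N (v l))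
        (rotated v N μ ν * fluctuation v N m ν + fluctuation v N m ν * rotated v N μ ν) := by
  have hW : ∀ μ, ad (siteSum N (v μ)) (fluctuation v N m ν * fluctuation v N m ν) =
      rotated v N μ ν * fluctuation v N m ν + fluctuation v N m ν * rotated v N μ ν := fun μ => by
    rw [ad_mul, ad_siteSum_fluctuation hv]
  have hlin : ∑ μ, driftCoeff ε h C m μ •
        (rotated v N μ ν * fluctuation v N m ν + fluctuation v N m ν * rotated v N μ ν) =
      ∑ μ, ∑ κ, (driftCoeff ε h C m μ * structureConst v μ ν κ) •
        (fluctuation v N m κ * fluctuation v N m ν + fluctuation v N m ν * fluctuation v N m κ)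
      + (2 * meanFieldVelocity v ε h C m ν) • fluctuation v N m ν := by
    rw [meanFieldVelocity, Finset.mul_sum, Finset.sum_smul, ← Finset.sum_add_distrib]
    refine Finset.sum_congr rfl fun μ _ => ?_
    rw [rotated_eq N m μ ν, add_mul, mul_add, smul_mul_assoc, mul_smul_comm, one_mul, mul_one,
      Finset.sum_mul, Finset.mul_sum, add_add_add_comm, ← Finset.sum_add_distrib, smul_add,
      Finset.smul_sum]
    congr 1
    · refine Finset.sum_congr rfl fun κ _ => ?_
      rw [smul_mul_assoc, mul_smul_comm, ← smul_add, smul_smul]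
    · module
  rw [generator_eq hh m hN]
  simp only [hW]
  rw [hlin]
  abel

/-- The squared size of the fluctuations in a positive functional. -/
def fluctuationSize (v : Fin (d ^ 2) → Matrix (Fin d) (Fin d) ℂ) (N : ℕ) (m : Fin (d ^ 2) → ℝ)
    (φ : QuasiLocal d →ₚ[ℂ] ℂ) : ℝ :=
  ∑ ν, gnsNorm φ (fluctuation v N m ν) ^ 2

theorem fluctuationSize_nonneg (N : ℕ) (m : Fin (d ^ 2) → ℝ) (φ : QuasiLocal d →ₚ[ℂ] ℂ) :
    0 ≤ fluctuationSize v N m φ :=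
  Finset.sum_nonneg fun _ _ => sq_nonneg _

theorem gnsNorm_sq_le_fluctuationSize (N : ℕ) (m : Fin (d ^ 2) → ℝ) (φ : QuasiLocal d →ₚ[ℂ] ℂ)
    (ν : Fin (d ^ 2)) : gnsNorm φ (fluctuation v N m ν) ^ 2 ≤ fluctuationSize v N m φ :=
  Finset.single_le_sum (f := fun ν => gnsNorm φ (fluctuation v N m ν) ^ 2)
    (fun _ _ => sq_nonneg _) (Finset.mem_univ ν)

theorem gnsNorm_mul_gnsNorm_le (N : ℕ) (m : Fin (d ^ 2) → ℝ) (φ : QuasiLocal d →ₚ[ℂ] ℂ)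
    (μ ν : Fin (d ^ 2)) :
    gnsNorm φ (fluctuation v N m μ) * gnsNorm φ (fluctuation v N m ν) ≤
      fluctuationSize v N m φ := by
  nlinarith [gnsNorm_sq_le_fluctuationSize (v := v) N m φ μ,
    gnsNorm_sq_le_fluctuationSize (v := v) N m φ ν,
    sq_nonneg (gnsNorm φ (fluctuation v N m μ) - gnsNorm φ (fluctuation v N m ν))]

/-- In a positive functional `φ`, the time derivative of the squared fluctuations is at most
proportional to their size, up to `O(1/N)`, with constants that do not depend on `N` and `φ`. -/
theorem exists_growth_bound (hv : IsHermitianONB v) (hh : h.IsHermitian) {R : ℝ} (hR0 : 0 ≤ R)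
    (hR : ∀ ν, siteBound (v ν) ≤ R) :
    ∃ K₁ K₂ : ℝ, 0 ≤ K₁ ∧ 0 ≤ K₂ ∧ ∀ (N : ℕ) (m : Fin (d ^ 2) → ℝ) (φ : QuasiLocal d →ₚ[ℂ] ℂ),
      0 < N → (∀ ν, |m ν| ≤ R) → ∀ ν,
      ‖φ (generator v ε h C N (fluctuation v N m ν * fluctuation v N m ν)
        - (2 * meanFieldVelocity v ε h C m ν) • fluctuation v N m ν)‖ ≤
      K₁ * fluctuationSize v N m φ + 1 / N * (K₂ * (φ 1).re) := by
  -- `F`, `B`, `b`, `c` bound the coefficients, `y` the norm of the fluctuations.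
  obtain ⟨F, hF⟩ : ∃ r : ℝ, r = ∑ μ, ∑ ν, ∑ κ, ‖structureConst v μ ν κ‖ := ⟨_, rfl⟩
  obtain ⟨B, hB⟩ : ∃ r : ℝ, r = ∑ μ, ∑ l, ‖couplingB h C μ l‖ := ⟨_, rfl⟩
  obtain ⟨b, hb⟩ : ∃ r : ℝ, r = ∑ μ, ∑ l, ‖orderingCoeff h C μ l‖ := ⟨_, rfl⟩
  obtain ⟨c, hc⟩ : ∃ r : ℝ, r = ∑ μ, ((∑ ν, ‖couplingB h C μ ν‖) * R + |ε μ|) := ⟨_, rfl⟩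
  obtain ⟨y, hy⟩ : ∃ r : ℝ, r = R + R * ‖(1 : QuasiLocal d)‖ := ⟨_, rfl⟩
  have hF0 : 0 ≤ F := hF ▸ Finset.sum_nonneg fun _ _ => Finset.sum_nonneg fun _ _ =>
    Finset.sum_nonneg fun _ _ => norm_nonneg _
  have hB0 : 0 ≤ B := hB ▸ Finset.sum_nonneg fun _ _ => Finset.sum_nonneg fun _ _ =>
    norm_nonneg _
  have hb0 : 0 ≤ b := hb ▸ Finset.sum_nonneg fun _ _ => Finset.sum_nonneg fun _ _ =>
    norm_nonneg _
  have hc0 : 0 ≤ c := hc ▸ Finset.sum_nonneg fun _ _ => add_nonneg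
    (mul_nonneg (Finset.sum_nonneg fun _ _ => norm_nonneg _) hR0) (abs_nonneg _)
  have hy0 : 0 ≤ y := by rw [hy]; positivity
  have hFle : ∀ μ ν, ∑ κ, ‖structureConst v μ ν κ‖ ≤ F := fun μ ν => hF ▸
    (Finset.single_le_sum (f := fun ν => ∑ κ, ‖structureConst v μ ν κ‖)
      (fun _ _ => Finset.sum_nonneg fun _ _ => norm_nonneg _) (Finset.mem_univ ν)).trans
    (Finset.single_le_sum (f := fun μ => ∑ ν, ∑ κ, ‖structureConst v μ ν κ‖)
      (fun _ _ => Finset.sum_nonneg fun _ _ => Finset.sum_nonneg fun _ _ => norm_nonneg _)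
      (Finset.mem_univ μ))
  refine ⟨c * F * 2 + B * (2 * (F * R)), B * (F * (F * R) * y)
    + b * (2 * (F * (F * R) * y + F * R * (F * R))), by positivity, by positivity, ?_⟩
  intro N m φ hN hm ν
  have hφ1 : 0 ≤ (φ 1).re := by
    rw [← gnsNorm_one_sq]
    positivity
  set E := fluctuationSize v N m φ with hE
  have hE0 : 0 ≤ E := fluctuationSize_nonneg N m φ
  set Y := fluctuation v N m with hY
  set T := rotated v N with hT
  have hYn : ∀ μ, ‖Y μ‖ ≤ y := by
    intro μ
    rw [hy]
    refine (norm_sub_le _ _).trans (add_le_add ((norm_meanField_le N _).trans (hR μ)) ?_)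
    rw [norm_smul]
    refine mul_le_mul_of_nonneg_right ?_ (norm_nonneg _)
    rw [Complex.norm_real]
    exact hm μ
  have hTn : ∀ μ l, ‖T μ l‖ ≤ F * R := fun μ l =>
    (norm_sum_smul_le _ fun κ => (norm_meanField_le N _).trans (hR κ)).trans
      (mul_le_mul_of_nonneg_right (hFle μ l) hR0)
  have hTsum : ∀ μ (x : Fin (d ^ 2) → QuasiLocal d), (∀ κ, ‖x κ‖ ≤ F * R) →
      ‖∑ κ, structureConst v μ ν κ • x κ‖ ≤ F * (F * R) := fun μ x hx =>
    (norm_sum_smul_le _ hx).trans (mul_le_mul_of_nonneg_right (hFle μ ν) (by positivity))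
  have hYsa : ∀ μ, IsSelfAdjoint (Y μ) := isSelfAdjoint_fluctuation hv N m
  have hYY : ∀ μ κ, ‖φ (Y μ * Y κ)‖ ≤ E := fun μ κ => by
    have h1 := norm_apply_star_mul_le φ (Y μ) (Y κ)
    rw [(hYsa μ).star_eq] at h1
    exact h1.trans (gnsNorm_mul_gnsNorm_le N m φ μ κ)
  have hcn : ∑ μ, ‖driftCoeff ε h C m μ‖ ≤ c := by
    rw [hc]
    refine Finset.sum_le_sum fun μ _ => ?_
    refine (norm_add_le _ _).trans (add_le_add ?_ ?_)
    · rw [Finset.sum_mul]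
      refine norm_sum_le_of_le _ fun κ _ => ?_
      rw [norm_mul, Complex.norm_real]
      exact mul_le_mul_of_nonneg_left (hm κ) (norm_nonneg _)
    · simp
  have hNi : ‖(1 / (N : ℂ))‖ = 1 / N := by simp
  have h1 : ‖φ (∑ μ, ∑ κ, (driftCoeff ε h C m μ * structureConst v μ ν κ) •
      (Y κ * Y ν + Y ν * Y κ))‖ ≤ c * F * (2 * E) := by
    refine (norm_apply_sum_sum_smul_le φ _ (M := 2 * E) fun μ κ => ?_).trans ?_
    · rw [map_add]
      linarith [norm_add_le (φ (Y κ * Y ν)) (φ (Y ν * Y κ)), hYY κ ν, hYY ν κ]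
    · refine mul_le_mul_of_nonneg_right ?_ (by positivity)
      calc ∑ μ, ∑ κ, ‖driftCoeff ε h C m μ * structureConst v μ ν κ‖
          = ∑ μ, ‖driftCoeff ε h C m μ‖ * ∑ κ, ‖structureConst v μ ν κ‖ := by
            simp [Finset.mul_sum]
        _ ≤ ∑ μ, ‖driftCoeff ε h C m μ‖ * F :=
            Finset.sum_le_sum fun μ _ => mul_le_mul_of_nonneg_left (hFle μ ν) (norm_nonneg _)
        _ = (∑ μ, ‖driftCoeff ε h C m μ‖) * F := by rw [Finset.sum_mul]
        _ ≤ c * F := mul_le_mul_of_nonneg_right hcn hF0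
  have h2 : ‖φ (∑ μ, ∑ l, couplingB h C μ l • ((T μ ν * Y ν + Y ν * T μ ν) * Y l))‖ ≤
      B * (2 * (F * R) * E + 1 / N * (F * (F * R) * y * (φ 1).re)) := by
    rw [hB]
    refine norm_apply_sum_sum_smul_le φ _ fun μ l => ?_
    -- Moving `Y ν` to the left of `T μ ν` costs a commutator of order `1/N`.
    have e : (T μ ν * Y ν + Y ν * T μ ν) * Y l =
        (2 : ℂ) • (Y ν * T μ ν * Y l) + ad (T μ ν) (Y ν) * Y l := by
      rw [ad_apply, two_smul]
      noncomm_ring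
    have e1 : ‖φ (Y ν * T μ ν * Y l)‖ ≤ F * R * E :=
      (norm_apply_mul_mul_le φ (hYsa ν) _ _).trans
        (mul_le_mul (hTn μ ν) (gnsNorm_mul_gnsNorm_le N m φ ν l)
          (mul_nonneg (gnsNorm_nonneg _ _) (gnsNorm_nonneg _ _)) (by positivity))
    have e2 : ‖φ (ad (T μ ν) (Y ν) * Y l)‖ ≤ 1 / N * (F * (F * R) * y * (φ 1).re) := by
      refine (norm_apply_le_norm φ _).trans ?_
      have e3 : ‖ad (T μ ν) (Y ν)‖ ≤ 1 / N * (F * (F * R)) := by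
        rw [hT, hY, ad_rotated_fluctuation hv, norm_smul, hNi]
        exact mul_le_mul_of_nonneg_left (hTsum μ _ fun κ => hTn κ ν) (by positivity)
      calc (φ 1).re * ‖ad (T μ ν) (Y ν) * Y l‖
          ≤ (φ 1).re * (1 / N * (F * (F * R)) * y) :=
            mul_le_mul_of_nonneg_left ((norm_mul_le _ _).trans
              (mul_le_mul e3 (hYn l) (norm_nonneg _) (by positivity))) hφ1
        _ = _ := by ring
    rw [e, map_add, map_smul]
    refine (norm_add_le _ _).trans (add_le_add ?_ e2)
    rw [norm_smul, Complex.norm_ofNat]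
    linarith
  have h3 : ‖φ ((1 / (N : ℂ)) • ∑ μ, ∑ l, orderingCoeff h C μ l • ad (siteSum N (v l))
        (T μ ν * Y ν + Y ν * T μ ν))‖ ≤
      1 / N * (b * (2 * (F * (F * R) * y + F * R * (F * R)) * (φ 1).re)) := by
    rw [map_smul, norm_smul, hNi]
    refine mul_le_mul_of_nonneg_left ?_ (by positivity)
    rw [hb]
    refine norm_apply_sum_sum_smul_le φ _ fun μ l => ?_
    refine (norm_apply_le_norm φ _).trans ?_
    rw [mul_comm]
    refine mul_le_mul_of_nonneg_right ?_ hφ1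
    rw [map_add, ad_mul, ad_mul, hY, ad_siteSum_fluctuation hv, hT, ad_siteSum_rotated hv]
    have e1 := hTsum μ _ fun κ => hTn l κ
    have e2 := hYn ν
    have e3 := hTn μ ν
    have e4 := hTn l ν
    have e5 : ∀ {p q : QuasiLocal d} {r s : ℝ}, ‖p‖ ≤ r → ‖q‖ ≤ s → ‖p * q‖ ≤ r * s :=
      fun hp hq => (norm_mul_le _ _).trans
        (mul_le_mul hp hq (norm_nonneg _) ((norm_nonneg _).trans hp))
    refine (norm_add_le _ _).trans ?_
    have e6 := (norm_add_le _ _).trans (add_le_add (e5 e1 e2) (e5 e3 e4))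
    have e7 := (norm_add_le _ _).trans (add_le_add (e5 e4 e3) (e5 e2 e1))
    refine (add_le_add e6 e7).trans (le_of_eq ?_)
    ring
  rw [generator_fluctuation_sq hv hh m hN, map_add, map_add]
  refine (norm_add₃_le).trans ((add_le_add (add_le_add h1 h2) h3).trans (le_of_eq ?_))
  ring

end Fluctuation

section Growth

variable {d : ℕ} {v : Fin (d ^ 2) → Matrix (Fin d) (Fin d) ℂ} {ε : Fin (d ^ 2) → ℝ}
  {h C : Matrix (Fin (d ^ 2)) (Fin (d ^ 2)) ℂ}

/-- The positive functional `φ ∘ γ_t`. -/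
def evolved (hv : IsHermitianONB v) (hh : h.IsHermitian) (hC : C.PosSemidef) (ε : Fin (d ^ 2) → ℝ)
    (φ : QuasiLocal d →ₚ[ℂ] ℂ) (N : ℕ) {t : ℝ} (ht : 0 ≤ t) : QuasiLocal d →ₚ[ℂ] ℂ :=
  functionalComp φ (dynamics v ε h C N t) fun _ hx => dynamics_nonneg hv hh hC N ht hx

theorem evolved_apply (hv : IsHermitianONB v) (hh : h.IsHermitian) (hC : C.PosSemidef)
    (φ : QuasiLocal d →ₚ[ℂ] ℂ) (N : ℕ) {t : ℝ} (ht : 0 ≤ t) (x : QuasiLocal d) :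
    evolved hv hh hC ε φ N ht x = φ (dynamics v ε h C N t x) := rfl

theorem evolved_one (hv : IsHermitianONB v) (hh : h.IsHermitian) (hC : C.PosSemidef)
    (φ : QuasiLocal d →ₚ[ℂ] ℂ) (N : ℕ) {t : ℝ} (ht : 0 ≤ t) :
    evolved hv hh hC ε φ N ht 1 = φ 1 := by
  rw [evolved_apply, dynamics_one]

theorem hasDerivAt_functional_dynamics (φ : QuasiLocal d →ₚ[ℂ] ℂ) (N : ℕ)
    {y : ℝ → QuasiLocal d} {y' : QuasiLocal d} {t : ℝ} (hy : HasDerivAt y y' t) :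
    HasDerivAt (fun s => φ (dynamics v ε h C N s (y s)))
      (φ (dynamics v ε h C N t (generator v ε h C N (y t) + y'))) t :=
  ((functionalCLM φ).restrictScalars ℝ).hasFDerivAt.comp_hasDerivAt t
    (hasDerivAt_dynamics_apply N hy)

/-- Grönwall estimate for the fluctuations along a solution of the mean-field equations. -/
theorem exists_fluctuationSize_le (hv : IsHermitianONB v) (hh : h.IsHermitian)
    (hC : C.PosSemidef) {m : Fin (d ^ 2) → ℝ → ℝ}
    (hm : ∀ ν t, HasDerivAt (fun s => (m ν s : ℂ))
      (meanFieldVelocity v ε h C (fun κ => m κ t) ν) t)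
    {R : ℝ} (hR : ∀ ν t, |m ν t| ≤ R) (φ : QuasiLocal d →ₚ[ℂ] ℂ) :
    ∃ K K' : ℝ, ∀ N : ℕ, 0 < N → ∀ (t : ℝ) (ht : 0 ≤ t),
      fluctuationSize v N (fun ν => m ν t) (evolved hv hh hC ε φ N ht) ≤
        (fluctuationSize v N (fun ν => m ν 0) φ + 1 / N * K') * Real.exp (K * t) := by
  set R' : ℝ := ∑ ν, siteBound (v ν) + max R 0 with hR'
  have hsum : ∀ ν, siteBound (v ν) ≤ ∑ ν, siteBound (v ν) := fun ν =>
    Finset.single_le_sum (f := fun ν => siteBound (v ν)) (fun ν _ => siteBound_nonneg (v ν))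
      (Finset.mem_univ ν)
  have hsum0 : 0 ≤ ∑ ν, siteBound (v ν) := Finset.sum_nonneg fun ν _ => siteBound_nonneg (v ν)
  obtain ⟨K₁, K₂, hK₁, hK₂, hbound⟩ := exists_growth_bound (ε := ε) (C := C) hv hh
    (add_nonneg hsum0 (le_max_right R 0))
    (fun ν => (hsum ν).trans (le_add_of_nonneg_right (le_max_right R 0)))
  have hφ1 : 0 ≤ (φ 1).re := by
    rw [← gnsNorm_one_sq]
    positivity
  set n : ℝ := ((d ^ 2 : ℕ) : ℝ) with hn
  have hn0 : 0 ≤ n := Nat.cast_nonneg _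
  -- The summand `1` makes the exponential rate positive.
  refine ⟨n * K₁ + 1, n * (K₂ * (φ 1).re), fun N hN t ht => ?_⟩
  set Z : ℝ → QuasiLocal d := fun s =>
    ∑ ν, fluctuation v N (fun κ => m κ s) ν * fluctuation v N (fun κ => m κ s) ν with hZ
  set Z' : ℝ → QuasiLocal d := fun s =>
    ∑ ν, -((2 * meanFieldVelocity v ε h C (fun κ => m κ s) ν) •
      fluctuation v N (fun κ => m κ s) ν) with hZ'
  have hZd : ∀ s, HasDerivAt Z (Z' s) s := by
    intro s
    refine HasDerivAt.fun_sum fun ν _ => ?_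
    have h1 : HasDerivAt (fun r => fluctuation v N (fun κ => m κ r) ν)
        (-(meanFieldVelocity v ε h C (fun κ => m κ s) ν • (1 : QuasiLocal d))) s :=
      ((hm ν s).smul_const (1 : QuasiLocal d)).const_sub (meanField N (v ν))
    refine (h1.mul h1).congr_deriv ?_
    rw [neg_mul, mul_neg, smul_mul_assoc, mul_smul_comm, one_mul, mul_one]
    module
  set g : ℝ → ℝ := fun s => (φ (dynamics v ε h C N s (Z s))).re with hg
  set g' : ℝ → ℝ := fun s =>
    (φ (dynamics v ε h C N s (generator v ε h C N (Z s) + Z' s))).re with hg'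
  have hgd : ∀ s, HasDerivAt g (g' s) s := fun s =>
    Complex.reCLM.hasFDerivAt.comp_hasDerivAt s (hasDerivAt_functional_dynamics φ N (hZd s))
  have hgE : ∀ s (hs : 0 ≤ s),
      g s = fluctuationSize v N (fun ν => m ν s) (evolved hv hh hC ε φ N hs) := by
    intro s hs
    simp only [hg, hZ, fluctuationSize, map_sum, Complex.re_sum]
    refine Finset.sum_congr rfl fun ν _ => ?_
    rw [gnsNorm_sq_re, (isSelfAdjoint_fluctuation hv N _ ν).star_eq, evolved_apply]
  have hg0 : g 0 = fluctuationSize v N (fun ν => m ν 0) φ := by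
    simp only [hg, hZ, dynamics_zero, fluctuationSize, map_sum, Complex.re_sum]
    refine Finset.sum_congr rfl fun ν _ => ?_
    rw [gnsNorm_sq_re, (isSelfAdjoint_fluctuation hv N _ ν).star_eq]
    rfl
  have hg'le : ∀ s, 0 ≤ s → g' s ≤ (n * K₁ + 1) * g s + n * (1 / N * (K₂ * (φ 1).re)) := by
    intro s hs
    have e1 : g' s = ((evolved hv hh hC ε φ N hs) (∑ ν, (generator v ε h C N
        (fluctuation v N (fun κ => m κ s) ν * fluctuation v N (fun κ => m κ s) ν)
        - (2 * meanFieldVelocity v ε h C (fun κ => m κ s) ν) •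
          fluctuation v N (fun κ => m κ s) ν))).re := by
      simp only [hg', hZ, hZ', evolved_apply, map_sum, ← Finset.sum_add_distrib, sub_eq_add_neg]
    have e2 : 0 ≤ g s := by
      rw [hgE s hs]
      exact fluctuationSize_nonneg _ _ _
    rw [e1]
    refine (Complex.re_le_norm _).trans ?_
    rw [map_sum]
    refine (norm_sum_le_of_le _ fun ν _ => hbound N _ (evolved hv hh hC ε φ N hs) hN
      (fun ν => (hR ν s).trans ((le_max_left R 0).trans (le_add_of_nonneg_left hsum0))) ν).trans ?_
    rw [Finset.sum_const, Finset.card_univ, Fintype.card_fin, nsmul_eq_mul, evolved_one,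
      ← hgE s hs]
    nlinarith
  have hgr := le_gronwallBound_of_liminf_deriv_right_le (f := g) (f' := g') (δ := g 0)
    (K := n * K₁ + 1) (ε := n * (1 / N * (K₂ * (φ 1).re))) (a := 0) (b := t)
    (fun s _ => (hgd s).continuousAt.continuousWithinAt)
    (fun s _ r hr => (hgd s).hasDerivWithinAt.liminf_right_slope_le hr) le_rfl
    (fun s hs => hg'le s hs.1) t ⟨ht, le_rfl⟩
  have hK : 1 ≤ n * K₁ + 1 := by nlinarith [mul_nonneg hn0 hK₁]
  rw [← hgE t ht]
  refine hgr.trans ?_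
  rw [gronwallBound_of_K_ne_0 (by linarith), sub_zero, hg0, add_mul]
  refine add_le_add_right ?_ _
  have hδ : 0 ≤ n * (1 / N * (K₂ * (φ 1).re)) := by positivity
  have hexp := Real.exp_pos ((n * K₁ + 1) * t)
  calc n * (1 / N * (K₂ * (φ 1).re)) / (n * K₁ + 1) * (Real.exp ((n * K₁ + 1) * t) - 1)
      ≤ n * (1 / N * (K₂ * (φ 1).re)) * Real.exp ((n * K₁ + 1) * t) := by
        refine (mul_le_mul_of_nonneg_left (sub_le_self _ zero_le_one)
          (div_nonneg hδ (by linarith))).trans ?_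
        exact mul_le_mul_of_nonneg_right (div_le_self hδ hK) hexp.le
    _ = _ := by ring

/-- Propagation of the law of large numbers: along a solution of the mean-field equations the
fluctuations vanish in the limit, uniformly on compact time intervals. -/
theorem exists_tendsto_gnsNorm_fluctuation (hv : IsHermitianONB v) (hh : h.IsHermitian)
    (hC : C.PosSemidef) {m : Fin (d ^ 2) → ℝ → ℝ}
    (hm : ∀ ν t, HasDerivAt (fun s => (m ν s : ℂ))
      (meanFieldVelocity v ε h C (fun κ => m κ t) ν) t)
    {R : ℝ} (hR : ∀ ν t, |m ν t| ≤ R) (φ : QuasiLocal d →ₚ[ℂ] ℂ)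
    (h0 : ∀ ν, Tendsto (fun N : ℕ => gnsNorm φ (fluctuation v N (fun κ => m κ 0) ν)) atTop (𝓝 0))
    (t : ℝ) :
    ∃ δ : ℕ → ℝ, Tendsto δ atTop (𝓝 0) ∧ ∀ N : ℕ, 0 < N → ∀ (s : ℝ) (hs : 0 ≤ s), s ≤ t → ∀ ν,
      gnsNorm (evolved hv hh hC ε φ N hs) (fluctuation v N (fun κ => m κ s) ν) ≤ δ N := by
  obtain ⟨K, K', hK⟩ := exists_fluctuationSize_le (ε := ε) hv hh hC hm hR φ
  refine ⟨fun N => Real.sqrt ((fluctuationSize v N (fun ν => m ν 0) φ + 1 / N * |K'|)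
    * Real.exp (|K| * t)), ?_, ?_⟩
  · have h1 : Tendsto (fun N : ℕ => fluctuationSize v N (fun ν => m ν 0) φ) atTop (𝓝 0) := by
      have := tendsto_finsetSum (Finset.univ : Finset (Fin (d ^ 2)))
        fun ν _ => (h0 ν).pow 2
      simpa [fluctuationSize] using this
    have h2 := ((h1.add ((tendsto_const_div_atTop_nhds_zero_nat (1 : ℝ)).mul_const |K'|)).mul_const
      (Real.exp (|K| * t))).sqrt
    simpa using h2
  · intro N hN s hs hst ν
    refine Real.le_sqrt_of_sq_le ((gnsNorm_sq_le_fluctuationSize N _ _ ν).trans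
      ((hK N hN s hs).trans ?_))
    have h3 := fluctuationSize_nonneg (v := v) N (fun ν => m ν 0) φ
    have h4 : 1 / (N : ℝ) * K' ≤ 1 / N * |K'| :=
      mul_le_mul_of_nonneg_left (le_abs_self _) (by positivity)
    have h5 : K * s ≤ |K| * t :=
      (mul_le_mul_of_nonneg_right (le_abs_self K) hs).trans
        (mul_le_mul_of_nonneg_left hst (abs_nonneg K))
    have h6 := Real.exp_le_exp.2 h5
    have h7 : 0 ≤ 1 / (N : ℝ) * |K'| := by positivity
    exact mul_le_mul (by linarith) h6 (Real.exp_pos _).le (by linarith)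

end Growth

/-! ### The limiting Hamiltonian -/

section Limit

variable {d : ℕ} {v : Fin (d ^ 2) → Matrix (Fin d) (Fin d) ℂ} {ε : Fin (d ^ 2) → ℝ}
  {h C : Matrix (Fin (d ^ 2)) (Fin (d ^ 2)) ℂ} {m : Fin (d ^ 2) → ℝ → ℝ}

/-- The mean-field Hamiltonian of a finite set of sites. -/
def hamiltonianOn (v : Fin (d ^ 2) → Matrix (Fin d) (Fin d) ℂ) (ε : Fin (d ^ 2) → ℝ)
    (h C : Matrix (Fin (d ^ 2)) (Fin (d ^ 2)) ℂ) (s : Finset ℕ) (m : Fin (d ^ 2) → ℝ → ℝ) (t : ℝ) :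
    QuasiLocal d :=
  (-Complex.I) • ∑ k ∈ s, ∑ μ, driftCoeff ε h C (fun ν => m ν t) μ • site d (k : ℤ) (v μ)

theorem limitHamiltonian_eq_hamiltonianOn (S : ℕ) :
    limitHamiltonian v ε h C S m = hamiltonianOn v ε h C (Finset.range S) m := rfl

theorem limitHamiltonian_eq (S : ℕ) (t : ℝ) :
    limitHamiltonian v ε h C S m t =
      (-Complex.I) • ∑ μ, driftCoeff ε h C (fun ν => m ν t) μ • siteSum S (v μ) := by
  rw [limitHamiltonian_eq_hamiltonianOn, hamiltonianOn, Finset.sum_comm]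
  simp only [siteSum, Finset.smul_sum]

theorem continuous_hamiltonianOn (hm : ∀ ν, Continuous (m ν)) (s : Finset ℕ) :
    Continuous (hamiltonianOn v ε h C s m) := by
  have hc : ∀ μ, Continuous fun t => driftCoeff ε h C (fun ν => m ν t) μ := fun μ =>
    (continuous_finsetSum _ fun ν _ =>
      continuous_const.mul (Complex.continuous_ofReal.comp (hm ν))).add continuous_const
  have h1 : Continuous fun t => ∑ k ∈ s, ∑ μ,
      driftCoeff ε h C (fun ν => m ν t) μ • site d (k : ℤ) (v μ) :=
    continuous_finsetSum _ fun k _ => continuous_finsetSum _ fun μ _ =>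
      (hc μ).smul continuous_const
  exact h1.const_smul (-Complex.I)

theorem isSelfAdjoint_limitHamiltonian (hv : IsHermitianONB v) (hC : C.IsHermitian) (S : ℕ)
    (t : ℝ) : IsSelfAdjoint (limitHamiltonian v ε h C S m t) := by
  rw [isSelfAdjoint_iff, limitHamiltonian_eq, star_smul, star_sum, Finset.smul_sum,
    Finset.smul_sum]
  refine Finset.sum_congr rfl fun μ _ => ?_
  rw [star_smul, star_driftCoeff hC, (isSelfAdjoint_siteSum S (hv.isHermitian μ)).star_eq]
  simp

theorem commute_hamiltonianOn {O : QuasiLocal d} {s : Finset ℕ}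
    (hO : ∀ k ∈ s, ∀ x, Commute O (site d (k : ℤ) x)) (t : ℝ) :
    Commute O (hamiltonianOn v ε h C s m t) :=
  (Commute.sum_right _ _ _ fun k hk => Commute.sum_right _ _ _ fun μ _ =>
    (hO k hk (v μ)).smul_right _).smul_right _

theorem isSupportedBelow_timeOrderedExp (hm : ∀ ν, Continuous (m ν)) (S : ℕ) (t : ℝ) :
    IsSupportedBelow (timeOrderedExp (limitHamiltonian v ε h C S m) t) S := fun k hk x =>
  (commute_timeOrderedExp (continuous_hamiltonianOn hm _) (fun s => commute_hamiltonianOn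
    (fun l hl y => commute_site (by have := Finset.mem_range.1 hl; omega) x y) s) t).symm

/-- Enlarging the system multiplies its propagator by a unitary that commutes with everything
supported in the smaller system. -/
theorem exists_timeOrderedExp_eq_mul (hv : IsHermitianONB v) (hC : C.IsHermitian)
    (hm : ∀ ν, Continuous (m ν)) {S S' : ℕ} (hS : S ≤ S') (t : ℝ) :
    ∃ W ∈ unitary (QuasiLocal d), (∀ O, IsSupportedBelow O S → Commute O W) ∧
      timeOrderedExp (limitHamiltonian v ε h C S' m) t =
        timeOrderedExp (limitHamiltonian v ε h C S m) t * W := by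
  set H := hamiltonianOn v ε h C (Finset.range S) m with hH
  set H' := hamiltonianOn v ε h C (Finset.Ico S S') m with hH'
  have hHc : Continuous H := continuous_hamiltonianOn hm _
  have hHc' : Continuous H' := continuous_hamiltonianOn hm _
  have hadd : limitHamiltonian v ε h C S' m = fun s => H s + H' s := by
    funext s
    rw [limitHamiltonian_eq_hamiltonianOn, hH, hH', hamiltonianOn, hamiltonianOn, hamiltonianOn,
      ← smul_add, Finset.sum_range_add_sum_Ico _ hS]
  have hcomm : ∀ O, IsSupportedBelow O S → ∀ s, Commute O (H' s) := fun O hO s =>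
    commute_hamiltonianOn (fun k hk x => hO k (by exact_mod_cast (Finset.mem_Ico.1 hk).1) x) s
  have hsa : ∀ s, IsSelfAdjoint (H' s) := fun s => by
    have h1 := (isSelfAdjoint_limitHamiltonian (ε := ε) (h := h) (m := m) hv hC S' s).sub
      (isSelfAdjoint_limitHamiltonian (ε := ε) (h := h) (m := m) hv hC S s)
    rw [hadd, limitHamiltonian_eq_hamiltonianOn] at h1
    have e : H s + H' s - hamiltonianOn v ε h C (Finset.range S) m s = H' s :=
      add_sub_cancel_left _ _
    exact e ▸ h1
  have hHS : ∀ s, IsSupportedBelow (H s) S := fun s k hk x =>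
    (commute_hamiltonianOn (fun l hl y =>
      commute_site (by have := Finset.mem_range.1 hl; omega) x y) s).symm
  refine ⟨timeOrderedExp H' t,
    (isPropagator_timeOrderedExp hHc').mem_unitary hHc' hsa t,
    fun O hO => commute_timeOrderedExp hHc' (hcomm O hO) t, ?_⟩
  rw [hadd, timeOrderedExp_add hHc hHc' fun s r => (hcomm (H r) (hHS r) s).symm]
  rfl

theorem conj_timeOrderedExp_eq (hv : IsHermitianONB v) (hC : C.IsHermitian)
    (hm : ∀ ν, Continuous (m ν)) {S S' : ℕ} (hS : S ≤ S') {O : QuasiLocal d}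
    (hO : IsSupportedBelow O S) (t : ℝ) :
    star (timeOrderedExp (limitHamiltonian v ε h C S' m) t) * O *
        timeOrderedExp (limitHamiltonian v ε h C S' m) t =
      star (timeOrderedExp (limitHamiltonian v ε h C S m) t) * O *
        timeOrderedExp (limitHamiltonian v ε h C S m) t := by
  obtain ⟨W, hW, hWc, e⟩ := exists_timeOrderedExp_eq_mul (ε := ε) (h := h) hv hC hm hS t
  have hU := isSupportedBelow_timeOrderedExp (v := v) (ε := ε) (h := h) (C := C) hm S t
  set U := timeOrderedExp (limitHamiltonian v ε h C S m) t
  have h1 : Commute (star U * O * U) W := hWc _ ((hU.star.mul hO).mul hU)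
  rw [e, star_mul]
  calc star W * star U * O * (U * W) = star W * ((star U * O * U) * W) := by
        simp only [mul_assoc]
    _ = star W * W * (star U * O * U) := by rw [h1.eq]; simp only [mul_assoc]
    _ = _ := by rw [hW.1, one_mul]

theorem conj_star_timeOrderedExp_eq (hv : IsHermitianONB v) (hC : C.IsHermitian)
    (hm : ∀ ν, Continuous (m ν)) {S S' : ℕ} (hS : S ≤ S') {O : QuasiLocal d}
    (hO : IsSupportedBelow O S) (t : ℝ) :
    timeOrderedExp (limitHamiltonian v ε h C S' m) t * O *
        star (timeOrderedExp (limitHamiltonian v ε h C S' m) t) =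
      timeOrderedExp (limitHamiltonian v ε h C S m) t * O *
        star (timeOrderedExp (limitHamiltonian v ε h C S m) t) := by
  obtain ⟨W, hW, hWc, e⟩ := exists_timeOrderedExp_eq_mul (ε := ε) (h := h) hv hC hm hS t
  set U := timeOrderedExp (limitHamiltonian v ε h C S m) t
  rw [e, star_mul]
  calc U * W * O * (star W * star U) = U * (W * O) * star W * star U := by
        simp only [mul_assoc]
    _ = U * O * (W * star W) * star U := by rw [← (hWc O hO).eq]; simp only [mul_assoc]
    _ = _ := by rw [hW.2, mul_one]

theorem timeOrderedExp_limitHamiltonian_mem_unitary (hv : IsHermitianONB v) (hC : C.IsHermitian)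
    (hm : ∀ ν, Continuous (m ν)) (S : ℕ) (t : ℝ) :
    timeOrderedExp (limitHamiltonian v ε h C S m) t ∈ unitary (QuasiLocal d) :=
  (isPropagator_timeOrderedExp (continuous_hamiltonianOn hm _)).mem_unitary
    (continuous_hamiltonianOn hm _) (isSelfAdjoint_limitHamiltonian hv hC S) t

/-- The automorphisms `α_t` of the quasi-local algebra, determined by the propagators of the finite
systems. -/
theorem exists_limit_automorphism (hv : IsHermitianONB v) (hC : C.IsHermitian)
    (hm : ∀ ν, Continuous (m ν)) (ε : Fin (d ^ 2) → ℝ)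
    (h : Matrix (Fin (d ^ 2)) (Fin (d ^ 2)) ℂ) (t : ℝ) :
    ∃ α : QuasiLocal d ≃⋆ₐ[ℂ] QuasiLocal d, ∀ (S : ℕ) (O : QuasiLocal d), IsSupportedBelow O S →
      α O = star (timeOrderedExp (limitHamiltonian v ε h C S m) t) * O *
        timeOrderedExp (limitHamiltonian v ε h C S m) t := by
  set U : ℕ → QuasiLocal d := fun S => timeOrderedExp (limitHamiltonian v ε h C S m) t
  have h1 : ∀ (S : ℕ) (O : QuasiLocal d), IsSupportedBelow O S →
      Tendsto (fun n => star (U n) * O * U n) atTop (𝓝 (star (U S) * O * U S)) :=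
    fun S O hO => tendsto_atTop_of_eventually_const fun n (hn : S ≤ n) =>
      conj_timeOrderedExp_eq hv hC hm hn hO t
  obtain ⟨α, hα⟩ := exists_limit_conj (W := U)
    (fun n => timeOrderedExp_limitHamiltonian_mem_unitary hv hC hm n t) (dense_isSupportedBelow d)
    (fun O ⟨S, hS⟩ => ⟨_, h1 S O hS⟩)
    (fun O ⟨S, hS⟩ => ⟨U S * O * star (U S), tendsto_atTop_of_eventually_const
      fun n (hn : S ≤ n) => conj_star_timeOrderedExp_eq hv hC hm hn hS t⟩)
  exact ⟨α, fun S O hO => tendsto_nhds_unique (hα O) (h1 S O hO)⟩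

/-! ### Convergence of the dynamics -/

/-- On an element supported below `S`, the generator differs from the commutator with the limiting
Hamiltonian by terms that are linear in the fluctuations or of order `1/N`. -/
theorem generator_sub_limitHamiltonian (hh : h.IsHermitian) {S N : ℕ} (hN : 0 < N) (hSN : S ≤ N)
    {P : QuasiLocal d} (hP : IsSupportedBelow P S) (t : ℝ) :
    generator v ε h C N P - Complex.I • ad (limitHamiltonian v ε h C S m t) P =
      ∑ μ, ∑ ν, couplingB h C μ ν •
        (ad (siteSum S (v μ)) P * fluctuation v N (fun κ => m κ t) ν)
      + (1 / (N : ℂ)) • ∑ μ, ∑ ν, orderingCoeff h C μ ν •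
          ad (siteSum S (v ν)) (ad (siteSum S (v μ)) P) := by
  have h1 : ∀ μ, IsSupportedBelow (ad (siteSum S (v μ)) P) S := fun μ =>
    ((isSupportedBelow_siteSum S (v μ)).mul hP).sub (hP.mul (isSupportedBelow_siteSum S (v μ)))
  have h2 : Complex.I • ad (limitHamiltonian v ε h C S m t) P =
      ∑ μ, driftCoeff ε h C (fun κ => m κ t) μ • ad (siteSum S (v μ)) P := by
    rw [limitHamiltonian_eq, map_smul, LinearMap.smul_apply, smul_smul, mul_neg, Complex.I_mul_I,
      neg_neg, one_smul]
    simp only [map_sum, LinearMap.sum_apply, map_smul, LinearMap.smul_apply]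
  rw [generator_eq hh (fun κ => m κ t) hN, h2]
  simp only [siteSum_ad_of_isSupportedBelow hP hSN, siteSum_ad_of_isSupportedBelow (h1 _) hSN]
  abel

/-- Convergence on local elements, by interpolating between `α_t(O)` and `γ_t(O)` with
`s ↦ γ_s(U_s U_t* O U_t U_s*)`. -/
theorem tendsto_dynamics_of_isSupportedBelow (hv : IsHermitianONB v) (hh : h.IsHermitian)
    (hC : C.PosSemidef) (hm : ∀ ν, Continuous (m ν)) (φ : QuasiLocal d →ₚ[ℂ] ℂ) {t : ℝ}
    (ht : 0 ≤ t) {δ : ℕ → ℝ} (hδ0 : Tendsto δ atTop (𝓝 0))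
    (hδ : ∀ N : ℕ, 0 < N → ∀ (s : ℝ) (hs : 0 ≤ s), s ≤ t → ∀ ν,
      gnsNorm (evolved hv hh hC ε φ N hs) (fluctuation v N (fun κ => m κ s) ν) ≤ δ N)
    {S : ℕ} {O : QuasiLocal d} (hO : IsSupportedBelow O S) :
    Tendsto (fun N : ℕ => φ (dynamics v ε h C N t O)) atTop
      (𝓝 (φ (star (timeOrderedExp (limitHamiltonian v ε h C S m) t) * O *
        timeOrderedExp (limitHamiltonian v ε h C S m) t))) := by
  set H := limitHamiltonian v ε h C S m with hH
  set U := timeOrderedExp H with hU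
  have hHc : Continuous H := continuous_hamiltonianOn hm _
  have hprop : IsPropagator H U := isPropagator_timeOrderedExp hHc
  have hHsa : ∀ s, IsSelfAdjoint (H s) := isSelfAdjoint_limitHamiltonian hv hC.isHermitian S
  have hUu : ∀ s, U s ∈ unitary (QuasiLocal d) := fun s => hprop.mem_unitary hHc hHsa s
  have hUS : ∀ s, IsSupportedBelow (U s) S := isSupportedBelow_timeOrderedExp hm S
  set Q : QuasiLocal d := star (U t) * O * U t with hQ
  have hQS : IsSupportedBelow Q S := ((hUS t).star.mul hO).mul (hUS t)
  set P : ℝ → QuasiLocal d := fun s => U s * Q * star (U s) with hP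
  have hPS : ∀ s, IsSupportedBelow (P s) S := fun s => ((hUS s).mul hQS).mul (hUS s).star
  have hPn : ∀ s, ‖P s‖ = ‖Q‖ := fun s => by
    rw [hP, CStarRing.norm_mul_mem_unitary _ (Unitary.star_mem (hUu s)),
      CStarRing.norm_mem_unitary_mul _ (hUu s)]
  have hP0 : P 0 = Q := by simp [hP, hprop.zero]
  have hPt : P t = O := by
    have h1 : U t * star (U t) = 1 := (hUu t).2
    calc U t * (star (U t) * O * U t) * star (U t)
        = (U t * star (U t)) * O * (U t * star (U t)) := by simp only [mul_assoc]
      _ = O := by rw [h1, one_mul, mul_one]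
  have hPd : ∀ s, HasDerivAt P (-(Complex.I • ad (H s) (P s))) s := by
    intro s
    refine (((hprop.hasDerivAt s).mul_const Q).mul (hprop.hasDerivAt_star hHsa s)).congr_deriv ?_
    rw [ad_apply, hP]
    simp only [smul_mul_assoc, mul_smul_comm, mul_assoc]
    module
  -- Bounds for the commutators with the collective operators of the first `S` sites.
  set r : ℝ := 2 * ∑ μ, ‖siteSum S (v μ)‖ with hr
  have hr0 : 0 ≤ r := mul_nonneg zero_le_two (Finset.sum_nonneg fun _ _ => norm_nonneg _)
  have had : ∀ μ x, ‖ad (siteSum S (v μ)) x‖ ≤ r * ‖x‖ := by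
    intro μ x
    refine (norm_ad_le _ _).trans (mul_le_mul_of_nonneg_right ?_ (norm_nonneg _))
    exact mul_le_mul_of_nonneg_left (Finset.single_le_sum (f := fun μ => ‖siteSum S (v μ)‖)
      (fun _ _ => norm_nonneg _) (Finset.mem_univ μ)) zero_le_two
  have hφ1 : 0 ≤ (φ 1).re := by
    rw [← gnsNorm_one_sq]
    positivity
  set B : ℝ := ∑ μ, ∑ ν, ‖couplingB h C μ ν‖ with hB
  set b : ℝ := ∑ μ, ∑ ν, ‖orderingCoeff h C μ ν‖ with hb
  set D : ℕ → ℝ := fun N => B * (r * ‖Q‖ * (Real.sqrt (φ 1).re * δ N))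
    + 1 / N * (b * ((φ 1).re * (r * (r * ‖Q‖)))) with hD
  have hDlim : Tendsto (fun N => D N * t) atTop (𝓝 0) := by
    have h1 := (((hδ0.const_mul (Real.sqrt (φ 1).re)).const_mul (r * ‖Q‖)).const_mul B).add
      ((tendsto_const_div_atTop_nhds_zero_nat (1 : ℝ)).mul_const (b * ((φ 1).re * (r * (r * ‖Q‖)))))
    simpa [hD] using h1.mul_const t
  rw [tendsto_iff_norm_sub_tendsto_zero]
  refine squeeze_zero' (Eventually.of_forall fun _ => norm_nonneg _) ?_ hDlim
  filter_upwards [eventually_ge_atTop (max S 1)] with N hN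
  have hN0 : 0 < N := lt_of_lt_of_le one_pos ((le_max_right S 1).trans hN)
  have hSN : S ≤ N := (le_max_left S 1).trans hN
  have hd : ∀ s, HasDerivAt (fun s => φ (dynamics v ε h C N s (P s)))
      (φ (dynamics v ε h C N s (generator v ε h C N (P s) - Complex.I • ad (H s) (P s)))) s := by
    intro s
    rw [sub_eq_add_neg]
    exact hasDerivAt_functional_dynamics φ N (hPd s)
  have hbound : ∀ s ∈ Set.Ico 0 t, ‖φ (dynamics v ε h C N s
      (generator v ε h C N (P s) - Complex.I • ad (H s) (P s)))‖ ≤ D N := by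
    intro s hs
    rw [← evolved_apply hv hh hC φ N hs.1,
      generator_sub_limitHamiltonian hh hN0 hSN (hPS s) s, map_add]
    have hone : gnsNorm (evolved hv hh hC ε φ N hs.1) 1 = Real.sqrt (φ 1).re := by
      rw [← evolved_one (ε := ε) hv hh hC φ N hs.1, ← gnsNorm_one_sq,
        Real.sqrt_sq (gnsNorm_nonneg _ _)]
    refine (norm_add_le _ _).trans (add_le_add ?_ ?_)
    · refine norm_apply_sum_sum_smul_le _ _ fun μ ν => ?_
      refine (norm_apply_mul_le _ _ _).trans ?_
      rw [hone]
      refine mul_le_mul ((had μ _).trans_eq (by rw [hPn])) ?_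
        (mul_nonneg (Real.sqrt_nonneg _) (gnsNorm_nonneg _ _))
        (mul_nonneg hr0 (norm_nonneg _))
      exact mul_le_mul_of_nonneg_left (hδ N hN0 s hs.1 hs.2.le ν) (Real.sqrt_nonneg _)
    · rw [map_smul, norm_smul]
      have hNi : ‖(1 / (N : ℂ))‖ = 1 / N := by simp
      rw [hNi]
      refine mul_le_mul_of_nonneg_left ?_ (by positivity)
      refine norm_apply_sum_sum_smul_le _ _ fun μ ν => ?_
      refine (norm_apply_le_norm _ _).trans ?_
      rw [evolved_one]
      refine mul_le_mul_of_nonneg_left ?_ hφ1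
      refine (had ν _).trans (mul_le_mul_of_nonneg_left ?_ hr0)
      exact (had μ _).trans_eq (by rw [hPn])
  have hmv := norm_image_sub_le_of_norm_deriv_le_segment'
    (fun s _ => (hd s).hasDerivWithinAt) hbound t ⟨ht, le_rfl⟩
  simpa [hPt, hP0, dynamics_zero] using hmv

/-! ### Convergence for all quasi-local elements -/

/-- Polarization of the vector functionals `x ↦ ω(c* x c)`. -/
theorem polarization (ω : QuasiLocal d →ₗ[ℂ] ℂ) (a b x : QuasiLocal d) :
    ω (a * x * b) = (1 / 4 : ℂ) *
      (ω (star (b + star a) * (x * (b + star a)))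
        + Complex.I * ω (star (b + Complex.I • star a) * (x * (b + Complex.I • star a)))
        - ω (star (b - star a) * (x * (b - star a)))
        - Complex.I * ω (star (b - Complex.I • star a) * (x * (b - Complex.I • star a)))) := by
  simp only [star_add, star_sub, star_smul, star_star, add_mul, sub_mul, mul_add, mul_sub,
    smul_mul_assoc, mul_smul_comm, map_add, map_sub, map_smul, smul_eq_mul, RCLike.star_def,
    Complex.conj_I, mul_assoc]
  linear_combination (1 / 2 * ω (a * (x * b)) - 1 / 2 * ω (star b * (x * star a))) *
    Complex.I_mul_I

end Limit

end SpinChain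

end

open SpinChain in
theorem theorem2 {d : ℕ}
    (v : Fin (d ^ 2) → Matrix (Fin d) (Fin d) ℂ) (hv : IsHermitianONB v)
    (ε : Fin (d ^ 2) → ℝ)
    (h : Matrix (Fin (d ^ 2)) (Fin (d ^ 2)) ℂ) (hh : h.IsHermitian)
    (C : Matrix (Fin (d ^ 2)) (Fin (d ^ 2)) ℂ) (hC : C.PosSemidef)
    (ω : QuasiLocal d →ₗ[ℂ] ℂ) (hω : IsState ω) (hτ : IsTranslationInvariant ω)
    (hcl : IsL1Clustering ω) :
    ∃ (m : Fin (d ^ 2) → ℝ → ℝ) (α : ℝ → (QuasiLocal d ≃⋆ₐ[ℂ] QuasiLocal d)),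
      (∀ ν, ∀ t : ℝ, 0 ≤ t →
        Tendsto (fun N : ℕ => ω (dynamics v ε h C N t (meanField N (v ν)))) atTop
          (𝓝 (m ν t : ℂ))) ∧
      (∀ ν, ContinuousOn (m ν) (Set.Ici 0)) ∧
      (∀ t : ℝ, 0 ≤ t → ∀ a b O : QuasiLocal d,
        Tendsto (fun N : ℕ => ω (a * dynamics v ε h C N t O * b)) atTop
          (𝓝 (ω (a * α t O * b)))) ∧
      (∀ (S : ℕ) (t : ℝ), 0 ≤ t →
        IsSelfAdjoint (limitHamiltonian v ε h C S m t) ∧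
        (Summable fun n : ℕ => ‖dysonTerm (limitHamiltonian v ε h C S m) n t‖) ∧
        timeOrderedExp (limitHamiltonian v ε h C S m) t ∈ unitary (QuasiLocal d) ∧
        ∀ O : QuasiLocal d, IsSupportedIn O 0 ((S : ℤ) - 1) →
          α t O = star (timeOrderedExp (limitHamiltonian v ε h C S m) t) * O *
            timeOrderedExp (limitHamiltonian v ε h C S m) t) := by
  obtain ⟨m, hm0, hmd, R, hR⟩ := exists_meanField_solution hv hC.isHermitian ε h
    (fun ν => (ω (site d 0 (v ν))).re)
  have hmc : ∀ ν, Continuous (m ν) := fun ν => by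
    have h1 : Continuous fun s => (m ν s : ℂ) :=
      continuous_iff_continuousAt.2 fun s => (hmd ν s).continuousAt
    exact (Complex.continuous_re.comp h1).congr fun s => Complex.ofReal_re _
  -- A positive functional is real on self-adjoint elements.
  have hreal : ∀ ν, ((m ν 0 : ℝ) : ℂ) = ω (site d 0 (v ν)) := fun ν => by
    rw [hm0]
    refine Complex.conj_eq_iff_re.1 ?_
    have h1 := map_star hω.toPositive (site d 0 (v ν))
    rw [← map_star, show star (v ν) = v ν from hv.isHermitian ν] at h1
    exact h1.symm
  have hfluct : ∀ c t, ∃ δ : ℕ → ℝ, Tendsto δ atTop (𝓝 0) ∧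
      ∀ N : ℕ, 0 < N → ∀ (s : ℝ) (hs : 0 ≤ s), s ≤ t → ∀ ν,
        gnsNorm (evolved hv hh hC ε (functionalConj hω.toPositive c) N hs)
          (fluctuation v N (fun κ => m κ s) ν) ≤ δ N := fun c t =>
    exists_tendsto_gnsNorm_fluctuation hv hh hC hmd hR _ (fun ν => by
      simp only [fluctuation, hreal]
      exact tendsto_gnsNorm_meanField_sub hω hτ hcl (hv.isHermitian ν) c) t
  choose α hα using exists_limit_automorphism hv hC.isHermitian hmc ε h
  have hconv : ∀ t : ℝ, 0 ≤ t → ∀ c O : QuasiLocal d,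
      Tendsto (fun N : ℕ => functionalConj hω.toPositive c (dynamics v ε h C N t O)) atTop
        (𝓝 (functionalConj hω.toPositive c (α t O))) := by
    intro t ht c O
    set φ := functionalConj hω.toPositive c with hφ
    have hφ1 : 0 ≤ (φ 1).re := by
      rw [← gnsNorm_one_sq]
      positivity
    obtain ⟨δ, hδ0, hδ⟩ := hfluct c t
    rw [Metric.tendsto_atTop]
    intro η hη
    -- Both `φ ∘ γ_t` and `φ ∘ α_t` are bounded by `φ(1)`, so that a dense set of `O` suffices.
    obtain ⟨O', ⟨S, hS⟩, hOO'⟩ := Metric.mem_closure_iff.1 (dense_isSupportedBelow d O)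
      (η / (3 * ((φ 1).re + 1))) (by positivity)
    rw [dist_eq_norm] at hOO'
    have hsmall : (φ 1).re * ‖O - O'‖ < η / 3 := by
      have h1 := (lt_div_iff₀ (by positivity)).1 hOO'
      nlinarith [norm_nonneg (O - O')]
    have hloc := tendsto_dynamics_of_isSupportedBelow hv hh hC hmc φ ht hδ0 hδ hS
    rw [← hα t S O' hS] at hloc
    obtain ⟨N₀, hN₀⟩ := Metric.tendsto_atTop.1 hloc (η / 3) (by positivity)
    refine ⟨N₀, fun N hN => ?_⟩
    have e1 : dist (φ (dynamics v ε h C N t O)) (φ (dynamics v ε h C N t O')) < η / 3 := by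
      rw [dist_eq_norm, ← map_sub, ← map_sub, ← evolved_apply hv hh hC φ N ht]
      refine (norm_apply_le_norm _ _).trans_lt ?_
      rwa [evolved_one]
    have e2 : dist (φ (α t O')) (φ (α t O)) < η / 3 := by
      rw [dist_comm, dist_eq_norm, ← map_sub, ← map_sub]
      refine (norm_apply_le_norm _ _).trans_lt ?_
      refine lt_of_le_of_lt (mul_le_mul_of_nonneg_left ?_ hφ1) hsmall
      exact NonUnitalStarAlgHom.norm_apply_le (α t) _
    calc dist (φ (dynamics v ε h C N t O)) (φ (α t O))
        ≤ dist (φ (dynamics v ε h C N t O)) (φ (dynamics v ε h C N t O'))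
          + dist (φ (dynamics v ε h C N t O')) (φ (α t O'))
          + dist (φ (α t O')) (φ (α t O)) := dist_triangle4 _ _ _ _
      _ < η / 3 + η / 3 + η / 3 := add_lt_add (add_lt_add e1 (hN₀ N hN)) e2
      _ = η := by ring
  refine ⟨m, α, ?_, fun ν => (hmc ν).continuousOn, ?_, ?_⟩
  · intro ν t ht
    obtain ⟨δ, hδ0, hδ⟩ := hfluct 1 t
    rw [tendsto_iff_norm_sub_tendsto_zero]
    refine squeeze_zero' (Eventually.of_forall fun _ => norm_nonneg _) ?_ hδ0
    filter_upwards [eventually_gt_atTop 0] with N hN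
    set φ := evolved hv hh hC ε (functionalConj hω.toPositive 1) N ht with hφ
    have hφa : ∀ x, φ x = ω (dynamics v ε h C N t x) := fun x => by
      rw [hφ, evolved_apply, functionalConj_apply, star_one, one_mul, mul_one,
        hω.toPositive_apply]
    have hφ1 : φ 1 = 1 := by rw [hφa, dynamics_one, hω.map_one]
    have hg1 : gnsNorm φ 1 = 1 := by
      have h1 := gnsNorm_one_sq φ
      rw [hφ1, Complex.one_re] at h1
      nlinarith [gnsNorm_nonneg φ 1]
    have e : ω (dynamics v ε h C N t (meanField N (v ν))) - (m ν t : ℂ) =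
        φ (fluctuation v N (fun κ => m κ t) ν) := by
      rw [fluctuation, map_sub, map_smul, hφ1, hφa, smul_eq_mul, mul_one]
    rw [e]
    refine (norm_apply_le_gnsNorm φ _).trans ?_
    rw [hg1, one_mul]
    exact hδ N hN t ht le_rfl ν
  · intro t ht a b O
    have h1 := hconv t ht
    simp only [functionalConj_apply, hω.toPositive_apply] at h1
    simp only [polarization ω a b]
    exact ((((h1 _ O).add ((h1 _ O).const_mul _)).sub (h1 _ O)).sub
      ((h1 _ O).const_mul _)).const_mul _
  · intro S t _
    exact ⟨isSelfAdjoint_limitHamiltonian hv hC.isHermitian S t,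
      summable_norm_dysonTerm (continuous_hamiltonianOn hmc _) t,
      timeOrderedExp_limitHamiltonian_mem_unitary hv hC.isHermitian hmc S t,
      fun O hO => hα t S O hO.isSupportedBelow⟩
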